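/- Let $\mu>0$, $w\in\mathbb R\setminus\{0\}$ and $0<\kappa<1$. Put $c_2(\kappa)=\bigl(2\Gamma(\kappa)\cos(\kappa\pi/2)\bigr)^{-1}$ and, for $u\ge 0$, $$\theta_\kappa(u)=\frac{\Gamma(\frac{\kappa+1}{2})}{\Gamma(\frac{3-\kappa}{2})}\Bigl(\frac u2\Bigr)^{1-\kappa} +\Gamma\Bigl(\frac{\kappa+1}{2}\Bigr)\sum_{m\ge1}\frac{(u/2)^{2m+1-\kappa}}{m!\,\Gamma(m-\frac{\kappa-1}{2}+1)} -\Gamma\Bigl(\frac{\kappa+1}{2}\Bigr)\sum_{m\ge1}\frac{(u/2)^{2m}}{m!\,\Gamma(m+\frac{\kappa-1}{2}+1)},$$ $$f_{\kappa,w}(\lambda)=\frac{c_2(\kappa)}2\left(\frac{1-\theta_\kappa(|\lambda+w|)}{|\lambda+w|^{1-\kappa}}+\frac{1-\theta_\kappa(|\lambda-w|)}{|\lambda-w|^{1-\kappa}}\right).$$ A complex Gaussian random measure with control measure $F$ on $\mathbb R$ is a centred jointly Gaussian additive family $Z(A)$, indexed by the Borel sets $A$ with $F(A)<\infty$, such that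 $\mathbb E\,Z(A)\overline{Z(B)}=F(A\cap B)$ and $Z(-A)=\overline{Z(A)}$ almost surely; integrals $\int g\,dZ$, $g\in L^2(F)$, are mean-square limits of integrals of simple functions. Complex white noise is the case in which $F$ is Lebesgue measure. Let $\eta(x)=\int_{\mathbb R}e^{i\lambda x}Z(d\lambda)$, $x\in\mathbb R$, be a real stationary zero-mean Gaussian process, where $Z$ is a complex Gaussian random measure with a finite control measure $F$, and suppose that $$\mathrm{Cov}(\eta(0),\eta(x))=\frac{\cos(wx)}{(1+x^2)^{\kappa/2}},\qquad x\in\mathbb R .$$ Let $$u(t,x)=\int_{\mathbb R}e^{i\lambda x-\mu\lambda^2t}\,Z(d\lambda),\qquad t>0,\ x\in\mathbb R,$$ be the solution of the heat equation $\partial u/\partial t=\mu\,\partial^2u/\partial x^2$ with initial condition $\eta$; it is real almost surely, and if $\eta$ is jointly measurable then for all $t>0$ and $x\in\mathbb R$, almost surely, $u(t,x)=(4\pi\mu t)^{-1/2}\int_{\mathbb R}\eta(y)e^{-(x-y)^2/(4\mu t)}dy$, the integral converging absolutely. For $\varepsilon>0$ let $U_\varepsilon(t,x)=\varepsilon^{-1/4}u(t/\varepsilon,x/\sqrt\varepsilon)$.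 Let $W$ be a complex white noise on $\mathbb R$ (possibly on another probability space) and, for $t>0$ and $x\in\mathbb R$, $$U_0(t,x)=\sqrt{\frac{c_2(\kappa)}{|w|^{1-\kappa}}\bigl(1-\theta_\kappa(|w|)\bigr)}\int_{\mathbb R}e^{i\lambda x-\mu t\lambda^2}\,W(d\lambda).$$ Then: 1. $U_0$ is almost surely real, and it is a zero-mean Gaussian random field with $$\mathrm{Cov}(U_0(t,x),U_0(t',x'))=\frac{c_2(\kappa)\sqrt\pi\,(1-\theta_\kappa(|w|))}{\sqrt\mu\,|w|^{1-\kappa}}\cdot\frac{e^{-\frac{(x-x')^2}{4\mu(t+t')}}}{\sqrt{t+t'}},\qquad t,t'>0,\ x,x'\in\mathbb R.$$ 2. As $\varepsilon\to0$, the finite-dimensional distributions of $U_\varepsilon$ on $(0,\infty)\times\mathbb R$ converge weakly to those of $U_0$. 3. For every $\varepsilon>0$ the field $V_\varepsilon(t,x)=\int_{\mathbb R}e^{i\lambda x-\mu\lambda^2t}\sqrt{f_{\kappa,w}(\lambda\sqrt\varepsilon)}\,W(d\lambda)$ is almost surely real and has the same finite-dimensional distributions as $U_\varepsilon$, and $\mathbb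 E|V_\varepsilon(t,x)-U_0(t,x)|^2\to0$ as $\varepsilon\to0$ for all $t>0$, $x\in\mathbb R$. 4. $U_0$ is stationary in space but not stationary in time. -/

import Mathlib

open MeasureTheory ProbabilityTheory Filter Topology
open scoped ENNReal

noncomputable section

/-! ### The constants and the spectral density -/

/-- `c₂(κ) = 1 / (2 Γ(κ) cos(κπ/2))`. -/
def cTwo (κ : ℝ) : ℝ := (2 * Real.Gamma κ * Real.cos (κ * Real.pi / 2))⁻¹

/-- The function `θ_κ(u)`, `u ≥ 0`, given by its series. The two series run over `m ≥ 1`, which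
is indexed here by `m = k + 1`, `k : ℕ`. -/
def theta (κ u : ℝ) : ℝ :=
  Real.Gamma ((κ + 1) / 2) / Real.Gamma ((3 - κ) / 2) * (u / 2) ^ (1 - κ)
    + Real.Gamma ((κ + 1) / 2) * ∑' k : ℕ,
        (u / 2) ^ (2 * ((k : ℝ) + 1) + 1 - κ) /
          ((k + 1).factorial * Real.Gamma ((k : ℝ) + 1 - (κ - 1) / 2 + 1))
    - Real.Gamma ((κ + 1) / 2) * ∑' k : ℕ,
        (u / 2) ^ (2 * (k + 1)) /
          ((k + 1).factorial * Real.Gamma ((k : ℝ) + 1 + (κ - 1) / 2 + 1))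

/-- The spectral density `f_{κ,w}`. -/
def specDensity (κ w l : ℝ) : ℝ :=
  cTwo κ / 2 * ((1 - theta κ |l + w|) / |l + w| ^ (1 - κ)
    + (1 - theta κ |l - w|) / |l - w| ^ (1 - κ))

/-! ### Complex Gaussian random measures and their stochastic integral -/

variable {Ω Ω' : Type*} [MeasurableSpace Ω] [MeasurableSpace Ω']

/-- `Z` is a complex (Hermitian) centred Gaussian orthogonal random measure on `ℝ` with control
measure `F`, i.e. `E |Z(dl)|² = F(dl)` and `Z(-A) = conj Z(A)`. It is defined on the Borel sets of
finite `F`-measure; its values on other sets play no role. -/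
structure IsGaussianRandomMeasure (F : Measure ℝ) (Z : Set ℝ → Ω → ℂ) (P : Measure Ω) :
    Prop where
  gaussian : IsGaussianProcess (fun A : {A : Set ℝ // MeasurableSet A ∧ F A < ∞} => Z A) P
  mean_zero : ∀ A, MeasurableSet A → F A < ∞ → ∫ ω, Z A ω ∂P = 0
  covariance : ∀ A B, MeasurableSet A → F A < ∞ → MeasurableSet B → F B < ∞ →
    ∫ ω, Z A ω * (starRingEnd ℂ) (Z B ω) ∂P = ((F (A ∩ B)).toReal : ℂ)
  additive : ∀ A B, MeasurableSet A → F A < ∞ → MeasurableSet B → F B < ∞ → Disjoint A B →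
    ∀ᵐ ω ∂P, Z (A ∪ B) ω = Z A ω + Z B ω
  hermitian : ∀ A, MeasurableSet A → F A < ∞ →
    ∀ᵐ ω ∂P, Z (Neg.neg ⁻¹' A) ω = (starRingEnd ℂ) (Z A ω)

/-- Complex (Hermitian) Gaussian white noise on `ℝ`: the control measure is Lebesgue measure. -/
def IsWhiteNoise (W : Set ℝ → Ω → ℂ) (P : Measure Ω) : Prop :=
  IsGaussianRandomMeasure volume W P

/-- The stochastic integral of a simple function. (The value `0` contributes nothing.) -/
def simpleIntegral (Z : Set ℝ → Ω → ℂ) (s : SimpleFunc ℝ ℂ) (ω : Ω) : ℂ :=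
  ∑ y ∈ s.range, y * Z (s ⁻¹' {y}) ω

/-- `X` is a version of `∫ g dZ`: the mean-square limit of the integrals of simple functions
that converge to `g` in `L²(F)`. -/
def IsStochIntegral (F : Measure ℝ) (Z : Set ℝ → Ω → ℂ) (P : Measure Ω)
    (g : ℝ → ℂ) (X : Ω → ℂ) : Prop :=
  MemLp g 2 F ∧ MemLp X 2 P ∧ ∃ s : ℕ → SimpleFunc ℝ ℂ,
    (∀ n, MemLp (s n) 2 F) ∧
    Tendsto (fun n => eLpNorm (fun l => s n l - g l) 2 F) atTop (𝓝 0) ∧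
    Tendsto (fun n => eLpNorm (fun ω => simpleIntegral Z (s n) ω - X ω) 2 P) atTop (𝓝 0)

open Classical in
/-- The stochastic integral `∫ g dZ` (a chosen version; `0` if there is none). -/
def stochIntegral (F : Measure ℝ) (Z : Set ℝ → Ω → ℂ) (P : Measure Ω) (g : ℝ → ℂ) : Ω → ℂ :=
  if h : ∃ X, IsStochIntegral F Z P g X then h.choose else 0

/-! ### The random fields -/

/-- The kernel `l ↦ exp(i l x - μ t l²)`. -/
def heatKernelFourier (μ t x : ℝ) (l : ℝ) : ℂ :=
  Complex.exp (Complex.I * l * x - μ * t * l ^ 2)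

/-- The integral `∫ exp(i l x - μ l² t) Z(dl)` as a complex random variable. -/
def solutionC (F : Measure ℝ) (Z : Set ℝ → Ω → ℂ) (P : Measure Ω) (μ t x : ℝ) : Ω → ℂ :=
  stochIntegral F Z P (heatKernelFourier μ t x)

/-- The solution `u(t,x)`, as a real random field. -/
def solution (F : Measure ℝ) (Z : Set ℝ → Ω → ℂ) (P : Measure Ω) (μ t x : ℝ) (ω : Ω) : ℝ :=
  (solutionC F Z P μ t x ω).re

/-- The rescaled solution `U_ε(t,x) = ε^{-1/4} u(t/ε, x/√ε)`. -/
def rescaled (F : Measure ℝ) (Z : Set ℝ → Ω → ℂ) (P : Measure Ω) (μ ε t x : ℝ) (ω : Ω) : ℝ :=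
  ε ^ (-(1 / 4) : ℝ) * solution F Z P μ (t / ε) (x / √ε) ω

/-- The limit field `U₀(t,x)` as a complex random variable. -/
def limitFieldC (W : Set ℝ → Ω → ℂ) (P : Measure Ω) (κ w μ t x : ℝ) (ω : Ω) : ℂ :=
  (√(cTwo κ / |w| ^ (1 - κ) * (1 - theta κ |w|)) : ℝ) *
    stochIntegral volume W P (heatKernelFourier μ t x) ω

/-- The limit field `U₀(t,x)`, as a real random field. -/
def limitField (W : Set ℝ → Ω → ℂ) (P : Measure Ω) (κ w μ t x : ℝ) (ω : Ω) : ℝ :=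
  (limitFieldC W P κ w μ t x ω).re

/-- The field `∫ exp(i l x - μ l² t) √(f_{κ,w}(l √ε)) W(dl)` as a complex random variable. -/
def coupledFieldC (W : Set ℝ → Ω → ℂ) (P : Measure Ω) (κ w μ ε t x : ℝ) : Ω → ℂ :=
  stochIntegral volume W P
    (fun l => heatKernelFourier μ t x l * (√(specDensity κ w (l * √ε)) : ℝ))

/-- The same field, as a real random field. -/
def coupledField (W : Set ℝ → Ω → ℂ) (P : Measure Ω) (κ w μ ε t x : ℝ) (ω : Ω) : ℝ :=
  (coupledFieldC W P κ w μ ε t x ω).re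

/-! ### Finite-dimensional distributions of random fields on `(0,∞) × ℝ` -/

/-- The vector `(X(t₁,x₁), …, X(tₙ,xₙ))`. -/
def fieldAt (X : ℝ → ℝ → Ω → ℝ) {n : ℕ} (t x : Fin n → ℝ) (ω : Ω) : Fin n → ℝ :=
  fun i => X (t i) (x i) ω

/-- Equality of all finite-dimensional distributions. -/
def SameFdd (X : ℝ → ℝ → Ω → ℝ) (P : Measure Ω) (Y : ℝ → ℝ → Ω' → ℝ) (P' : Measure Ω') : Prop :=
  ∀ (n : ℕ) (t x : Fin n → ℝ), (∀ i, 0 < t i) →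
    IdentDistrib (fieldAt X t x) (fieldAt Y t x) P P'

/-- Weak convergence of all finite-dimensional distributions as `ε → 0`, `ε > 0`. -/
def FddTendsto (X : ℝ → ℝ → ℝ → Ω → ℝ) (P : Measure Ω) [IsProbabilityMeasure P]
    (Y : ℝ → ℝ → Ω' → ℝ) (P' : Measure Ω') [IsProbabilityMeasure P'] : Prop :=
  ∀ (n : ℕ) (t x : Fin n → ℝ), (∀ i, 0 < t i) →
    TendstoInDistribution (fun ε : Set.Ioi (0 : ℝ) => fieldAt (X ε) t x)
      (comap ((↑) : Set.Ioi (0 : ℝ) → ℝ) (𝓝 0)) (fieldAt Y t x) (fun _ => P) P'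

/-- Stationarity in the space variable. -/
def StationaryInSpace (X : ℝ → ℝ → Ω → ℝ) (P : Measure Ω) : Prop :=
  ∀ h : ℝ, SameFdd (fun t x => X t (x + h)) P X P

/-- Stationarity in the time variable. -/
def StationaryInTime (X : ℝ → ℝ → Ω → ℝ) (P : Measure Ω) : Prop :=
  ∀ h : ℝ, 0 < h → SameFdd (fun t x => X (t + h) x) P X P

end

/-! All the fields are centred Gaussian, so their laws are determined by covariances. The theorem
reduces to finding the spectral density of `η` and to one limit of kernels in `L²(ℝ)`.

Spectral density. The Gamma integral writes `(1 + x²)^(-κ/2)` as a mixture of the Gaussians `exp(-x²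
s)`, `s > 0`. Hence its spectral density is a mixture of Gaussian densities, `mixtureDensity`, which
is positive and continuous off `0`. The factor `cos(wx)` averages the translates by `±w`, and
uniqueness of characteristic functions gives `F(dl) = f(l) dl` with `f = f_{κ,w}`
(`spectralMeasure_eq`). To recognise `θ_κ` in it (`mixtureDensity_eq`), rescale the mixture to `∫₀^∞
r^(-ν-1) exp(-y(r + 1/r)) dr` with `ν = (1-κ)/2`, and cut it at `r = 1`. Inversion exchanges the
halves up to `ν ↦ -ν`. Expanding `exp(-y/r)` leaves incomplete Gamma functions: their Gamma parts
sum to the two series of Bessel `I` type, and the remaining double series is odd in `ν` and cancels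
(`integral_bessel_eq`).

Limit. The substitution `l ↦ l√ε` in the covariance shows that `U_ε` has the law of `V_ε`
(`sameFdd_rescaled_coupledField`). `V_ε` and `U₀` are integrals against the same white noise, so
their mean-square distance is the `L²` distance between `exp(-μtl²) √f(l√ε)` and `exp(-μtl²) √f(0)`.
As `w ≠ 0`, `f` is continuous at `0`; its singularities sit at `l = ±w/√ε`, where the Gaussian
factor suppresses them (`tendsto_integral_scaled_specDensity`). Mean-square convergence then gives
convergence of the finite-dimensional distributions.

The stochastic integral is only a chosen version. Its existence, uniqueness and linearity come from
the isometry through `norm_sub_eq_of_inner_eq`, and the heat semigroup formula from an orthogonality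
argument. Stationarity is read off the covariance: it depends on space through `x - x'`, but the
variance decays like `t^(-1/2)`. -/

/-! ### A power series for the modified Bessel function of the second kind -/

/-- The generalised exponential integral `∫₁^∞ r^(a-1) exp(-y r) dr`. -/
noncomputable def expIntegral (a y : ℝ) : ℝ :=
  ∫ r in Set.Ioi (1 : ℝ), r ^ (a - 1) * Real.exp (-(y * r))

lemma integrableOn_expIntegral (a : ℝ) {y : ℝ} (hy : 0 < y) :
    IntegrableOn (fun r : ℝ => r ^ (a - 1) * Real.exp (-(y * r))) (Set.Ioi 1) := by
  -- On `r > 1` the power grows with its exponent, so `a - 1` may be replaced by `|a|`, for which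
  -- the integral also converges at `0`.
  have h := (integrableOn_rpow_mul_exp_neg_mul_rpow (s := |a|) (p := 1) (b := y)
    (by linarith [abs_nonneg a]) one_pos hy).mono_set
    (Set.Ioi_subset_Ioi (zero_le_one (α := ℝ)))
  refine h.mono' ?_ ?_
  · refine (ContinuousOn.mul ?_ ?_).aestronglyMeasurable measurableSet_Ioi
    · refine continuousOn_id.rpow_const fun x hx => Or.inl ?_
      have : (1 : ℝ) < x := hx
      simp only [id]; linarith
    · fun_prop
  · refine (ae_restrict_iff' measurableSet_Ioi).2 (ae_of_all _ fun r hr => ?_)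
    have hr' : (1 : ℝ) < r := hr
    have : 0 < r := by linarith
    rw [Real.norm_of_nonneg (by positivity), Real.rpow_one, neg_mul]
    gcongr
    · exact hr'.le
    · linarith [le_abs_self a]

/-- Integration by parts: `r ^ a * exp (-y r)` vanishes at infinity and equals `exp (-y)` at `r =
1`. -/
lemma expIntegral_add_one (a : ℝ) {y : ℝ} (hy : 0 < y) :
    y * expIntegral (a + 1) y = Real.exp (-y) + a * expIntegral a y := by
  have hi := integrableOn_expIntegral a hy
  have hi' := integrableOn_expIntegral (a + 1) hy
  have h := integral_Ioi_of_hasDerivAt_of_tendsto (a := 1) (m := 0)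
    (f := fun r : ℝ => r ^ a * Real.exp (-y * r))
    (f' := fun r : ℝ => a * (r ^ (a - 1) * Real.exp (-(y * r)))
      - y * (r ^ (a + 1 - 1) * Real.exp (-(y * r)))) ?_ ?_ ?_
    (tendsto_rpow_mul_exp_neg_mul_atTop_nhds_zero a y hy)
  · rw [integral_sub (hi.const_mul a) (hi'.const_mul y), integral_const_mul,
      integral_const_mul] at h
    simp only [Real.one_rpow, mul_one, one_mul] at h
    simp only [expIntegral]
    linarith
  · refine ContinuousAt.continuousWithinAt ?_
    refine ContinuousAt.mul (Real.continuousAt_rpow_const _ _ (Or.inl one_ne_zero)) ?_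
    fun_prop
  · intro r hr
    have hr' : r ≠ 0 := by have : (1 : ℝ) < r := hr; linarith
    have h1 := (Real.hasDerivAt_rpow_const (x := r) (p := a) (Or.inl hr'))
    have h2 : HasDerivAt (fun r : ℝ => Real.exp (-y * r)) (Real.exp (-y * r) * (-y)) r := by
      simpa using ((hasDerivAt_id r).const_mul (-y)).exp
    refine (h1.mul h2).congr_deriv ?_
    rw [add_sub_cancel_right, ← neg_mul]
    ring
  · exact (hi.const_mul a).sub (hi'.const_mul y)

/-- The number `δ` measures the distance of `a` from the poles of `Γ`. A uniform bound, rather than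
mere non-vanishing of `a + k`, is what later makes the double series summable with one constant. -/
lemma abs_neg_pow_div_factorial_mul_le {a δ : ℝ} (hδ : 0 < δ) (ha : ∀ k : ℕ, δ ≤ |a + k|)
    {y : ℝ} (hy : 0 ≤ y) (k : ℕ) :
    |(-y) ^ k / (k.factorial * (a + k))| ≤ y ^ k / k.factorial * δ⁻¹ := by
  have h0 : (0 : ℝ) < k.factorial := by positivity
  rw [abs_div, abs_pow, abs_neg, abs_of_nonneg hy, abs_mul, abs_of_pos h0, ← div_div,
    div_eq_mul_inv (y ^ k / _)]
  gcongr
  exact ha k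

lemma summable_neg_pow_div_factorial_mul {a δ : ℝ} (hδ : 0 < δ) (ha : ∀ k : ℕ, δ ≤ |a + k|)
    {y : ℝ} (hy : 0 ≤ y) :
    Summable fun k : ℕ => (-y) ^ k / (k.factorial * (a + k)) :=
  .of_norm_bounded ((Real.summable_pow_div_factorial y).mul_right _)
    (abs_neg_pow_div_factorial_mul_le hδ ha hy)

lemma hasSum_real_exp (x : ℝ) : HasSum (fun n : ℕ => x ^ n / n.factorial) (Real.exp x) := by
  rw [Real.exp_eq_exp_ℝ]
  exact NormedSpace.expSeries_div_hasSum_exp x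

/-- Since `a / (a + k) = 1 - k / (a + k)`, the left side is the exponential series minus a series
whose `k = 0` term vanishes; shifting the index gives the factor `y`. -/
lemma tsum_neg_pow_div_factorial_mul_recursion {a δ : ℝ} (hδ : 0 < δ)
    (ha : ∀ k : ℕ, δ ≤ |a + k|) {y : ℝ} (hy : 0 ≤ y) :
    a * ∑' k : ℕ, (-y) ^ k / (k.factorial * (a + k)) =
      Real.exp (-y) + y * ∑' k : ℕ, (-y) ^ k / (k.factorial * (a + 1 + k)) := by
  have ha' : ∀ k : ℕ, δ ≤ |a + 1 + k| := fun k => by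
    have := ha (k + 1); push_cast at this; convert this using 2; ring
  have hne : ∀ k : ℕ, a + k ≠ 0 := fun k h => by
    have := ha k; rw [h, abs_zero] at this; linarith
  have h1 := (summable_neg_pow_div_factorial_mul hδ ha hy).hasSum
  have h2 := (summable_neg_pow_div_factorial_mul hδ ha' hy).hasSum
  have h3 : HasSum (fun k : ℕ => (-y) ^ k / k.factorial
      - a * ((-y) ^ k / (k.factorial * (a + k)))) (Real.exp (-y) - a * _) :=
    (hasSum_real_exp (-y)).sub (h1.mul_left a)
  have h4 := (hasSum_nat_add_iff' 1).2 h3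
  have h5 : HasSum (fun k : ℕ => -(y * ((-y) ^ k / (k.factorial * (a + 1 + k))))) (-(y * _)) :=
    (h2.mul_left y).neg
  have h6 := h4.unique (h5.congr_fun ?_)
  · have ha0 : a ≠ 0 := by simpa using hne 0
    simp only [Finset.sum_range_one, pow_zero, Nat.factorial_zero, Nat.cast_one, Nat.cast_zero,
      add_zero, one_mul, div_one] at h6
    rw [mul_one_div_cancel ha0] at h6
    linarith
  · intro k
    have e1 := hne (k + 1)
    push_cast at e1
    have e2 : a + 1 + k ≠ 0 := by convert e1 using 1; ring
    have e3 : (k.factorial : ℝ) ≠ 0 := by positivity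
    have e4 : (k + 1 : ℝ) ≠ 0 := by positivity
    rw [Nat.factorial_succ]
    push_cast
    field_simp
    ring

/-- The integral over `(0, ∞)` is a Gamma integral; the part over `(0, 1]`, where `a > 0` gives
convergence, is integrated term by term. -/
lemma expIntegral_eq_of_pos {a y : ℝ} (ha : 0 < a) (hy : 0 < y) :
    expIntegral a y =
      y ^ (-a) * Real.Gamma a - ∑' k : ℕ, (-y) ^ k / (k.factorial * (a + k)) := by
  have h0 : IntegrableOn (fun r : ℝ => r ^ (a - 1) * Real.exp (-(y * r))) (Set.Ioi 0) := by
    have := integrableOn_rpow_mul_exp_neg_mul_rpow (s := a - 1) (p := 1) (b := y)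
      (by linarith) one_pos hy
    simpa only [Real.rpow_one, neg_mul] using this
  have h1 := Real.integral_rpow_mul_exp_neg_mul_Ioi ha hy
  rw [← Set.Ioc_union_Ioi_eq_Ioi (zero_le_one (α := ℝ)), setIntegral_union
    (Set.Ioc_disjoint_Ioi le_rfl) measurableSet_Ioi (h0.mono_set Set.Ioc_subset_Ioi_self)
    (integrableOn_expIntegral a hy)] at h1
  have hk : ∀ k : ℕ, ∫ r in Set.Ioc (0 : ℝ) 1, r ^ (a - 1 + k) = (a + k)⁻¹ := fun k => by
    have hk0 : (0 : ℝ) ≤ k := k.cast_nonneg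
    rw [← intervalIntegral.integral_of_le zero_le_one, integral_rpow (Or.inl (by linarith)),
      Real.one_rpow, Real.zero_rpow (by linarith)]
    simp only [sub_zero, one_div]
    congr 1; ring
  have hki : ∀ k : ℕ, IntegrableOn (fun r : ℝ => r ^ (a - 1 + k)) (Set.Ioc (0 : ℝ) 1) :=
    fun k => by
      have hk0 : (0 : ℝ) ≤ k := k.cast_nonneg
      rw [← intervalIntegrable_iff_integrableOn_Ioc_of_le zero_le_one]
      exact intervalIntegral.intervalIntegrable_rpow' (by linarith)
  have h2 := hasSum_integral_of_summable_integral_norm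
    (μ := volume.restrict (Set.Ioc (0 : ℝ) 1))
    (F := fun (k : ℕ) (r : ℝ) => (-y) ^ k / k.factorial * r ^ (a - 1 + k))
    (fun k => (hki k).const_mul _) ?_
  · have h3 : ∫ r in Set.Ioc (0 : ℝ) 1, r ^ (a - 1) * Real.exp (-(y * r)) =
        ∑' k : ℕ, (-y) ^ k / (k.factorial * (a + k)) := by
      refine Eq.trans ?_ (h2.tsum_eq.symm.trans (tsum_congr fun k => ?_))
      · refine setIntegral_congr_fun measurableSet_Ioc fun r hr => ?_
        rw [← neg_mul, ← (hasSum_real_exp (-y * r)).tsum_eq, ← tsum_mul_left]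
        refine tsum_congr fun k => ?_
        rw [Real.rpow_add hr.1, Real.rpow_natCast, mul_pow]
        ring
      · rw [integral_const_mul, hk, ← div_eq_mul_inv, div_div]
    rw [h3, one_div, Real.inv_rpow hy.le, ← Real.rpow_neg hy.le] at h1
    simp only [expIntegral]
    linarith
  · have : ∀ k : ℕ, ∫ r in Set.Ioc (0 : ℝ) 1, ‖(-y) ^ k / k.factorial * r ^ (a - 1 + k)‖ =
        y ^ k / k.factorial * (a + k)⁻¹ := fun k => by
      rw [← hk k, ← integral_const_mul]
      refine setIntegral_congr_fun measurableSet_Ioc fun r hr => ?_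
      have hr0 := hr.1
      rw [norm_mul, Real.norm_of_nonneg (Real.rpow_nonneg hr0.le _), norm_div, norm_pow, norm_neg,
        Real.norm_of_nonneg hy.le, Real.norm_of_nonneg (by positivity)]
    simp_rw [this]
    refine Summable.of_nonneg_of_le (fun k => by positivity) (fun k => ?_)
      ((Real.summable_pow_div_factorial y).mul_right a⁻¹)
    gcongr
    exact le_add_of_nonneg_right k.cast_nonneg

/-- Both sides satisfy the same recursion in `a`, and `Γ(a + 1) = a Γ(a)`. So the case `a > 0`
descends by unit steps past the poles, the number of steps being any natural number above `-a`. -/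
lemma expIntegral_eq {a δ : ℝ} (hδ : 0 < δ) (ha : ∀ k : ℕ, δ ≤ |a + k|) {y : ℝ} (hy : 0 < y) :
    expIntegral a y =
      y ^ (-a) * Real.Gamma a - ∑' k : ℕ, (-y) ^ k / (k.factorial * (a + k)) := by
  obtain ⟨n, hn⟩ := exists_nat_gt (-a)
  induction n generalizing a with
  | zero => exact expIntegral_eq_of_pos (by simpa using hn) hy
  | succ n ih =>
    have ha' : ∀ k : ℕ, δ ≤ |a + 1 + k| := fun k => by
      have := ha (k + 1); push_cast at this; convert this using 2; ring
    have ha0 : a ≠ 0 := fun h => by have := ha 0; simp [h] at this; linarith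
    have h1 := ih ha' (by push_cast at hn; linarith)
    have h2 := expIntegral_add_one a hy
    have h3 := tsum_neg_pow_div_factorial_mul_recursion hδ ha hy.le
    rw [Real.Gamma_add_one ha0, neg_add, Real.rpow_add hy, Real.rpow_neg_one] at h1
    apply mul_left_cancel₀ ha0
    rw [mul_sub, h3]
    rw [h1] at h2
    have : y * (y ^ (-a) * y⁻¹ * (a * Real.Gamma a)) = a * (y ^ (-a) * Real.Gamma a) := by
      field_simp
    linarith

/-- The part over `(1, ∞)` of the integral `∫₀^∞ r^(-ν-1) exp(-y (r + 1/r)) dr`. -/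
noncomputable def besselTail (ν y : ℝ) : ℝ :=
  ∫ r in Set.Ioi (1 : ℝ), r ^ (-ν - 1) * Real.exp (-(y * r)) * Real.exp (-(y / r))

/-- Expand `exp (-(y / r))`. As `r > 1`, each `expIntegral (-ν - m) y` is at most `expIntegral (-ν)
y`, which justifies termwise integration. -/
lemma hasSum_besselTail (ν : ℝ) {y : ℝ} (hy : 0 < y) :
    HasSum (fun m : ℕ => (-y) ^ m / m.factorial * expIntegral (-ν - m) y) (besselTail ν y) := by
  have h := hasSum_integral_of_summable_integral_norm
    (μ := volume.restrict (Set.Ioi (1 : ℝ)))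
    (F := fun (m : ℕ) (r : ℝ) => (-y) ^ m / m.factorial *
      (r ^ (-ν - m - 1) * Real.exp (-(y * r))))
    (fun m => Integrable.const_mul (integrableOn_expIntegral (-ν - m) hy) _) ?_
  · simp_rw [integral_const_mul] at h
    refine (?_ : besselTail ν y = _) ▸ h
    refine setIntegral_congr_fun measurableSet_Ioi fun r hr => ?_
    have hr0 : 0 < r := zero_lt_one.trans hr
    rw [← neg_div, ← (hasSum_real_exp (-y / r)).tsum_eq, ← tsum_mul_left]
    refine tsum_congr fun m => ?_
    rw [show -ν - m - 1 = -ν - 1 - m by ring, Real.rpow_sub hr0 _ (m : ℝ), Real.rpow_natCast,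
      div_pow]
    ring
  · refine Summable.of_nonneg_of_le (fun m => integral_nonneg fun r => norm_nonneg _) (fun m => ?_)
      ((Real.summable_pow_div_factorial y).mul_right (expIntegral (-ν) y))
    have hm : (0 : ℝ) < m.factorial := by positivity
    have : ∀ r : ℝ, r ∈ Set.Ioi (1 : ℝ) →
        ‖(-y) ^ m / m.factorial * (r ^ (-ν - m - 1) * Real.exp (-(y * r)))‖ =
        y ^ m / m.factorial * (r ^ (-ν - m - 1) * Real.exp (-(y * r))) := fun r hr => by
      have hr0 : 0 < r := zero_lt_one.trans hr
      have h1 : 0 ≤ r ^ (-ν - m - 1) * Real.exp (-(y * r)) := by positivity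
      rw [norm_mul, Real.norm_of_nonneg h1, norm_div, norm_pow, norm_neg,
        Real.norm_of_nonneg hy.le, Real.norm_of_nonneg hm.le]
    rw [setIntegral_congr_fun measurableSet_Ioi this, integral_const_mul]
    gcongr
    refine setIntegral_mono_on (integrableOn_expIntegral _ hy) (integrableOn_expIntegral _ hy)
      measurableSet_Ioi fun r hr => ?_
    have hr1 : 1 < r := hr
    gcongr
    · exact hr1.le
    · linarith [(m.cast_nonneg : (0 : ℝ) ≤ m)]

/-- Absolute summability turns the iterated sum into a sum over pairs, on which the two indices can
be exchanged. The differences of indices run over all integers, hence the condition on every `j :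
ℤ`. -/
lemma summable_besselTail_double {ν δ : ℝ} (hδ : 0 < δ) (hν : ∀ j : ℤ, δ ≤ |ν + j|)
    {y : ℝ} (hy : 0 < y) :
    Summable fun p : ℕ × ℕ => (-y) ^ p.1 / p.1.factorial *
      ((-y) ^ p.2 / (p.2.factorial * (-ν - p.1 + p.2))) := by
  have hs := Real.summable_pow_div_factorial y
  refine .of_norm_bounded (g := fun p : ℕ × ℕ => y ^ p.1 / p.1.factorial *
    (y ^ p.2 / p.2.factorial * δ⁻¹)) (hs.mul_of_nonneg (hs.mul_right _)
      (fun _ => by positivity) (fun _ => by positivity)) fun p => ?_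
  have hm : (0 : ℝ) < p.1.factorial := by positivity
  rw [norm_mul, norm_div, norm_pow, norm_neg, Real.norm_of_nonneg hy.le, Real.norm_of_nonneg hm.le]
  gcongr
  refine abs_neg_pow_div_factorial_mul_le hδ (fun k => ?_) hy.le p.2
  have := hν (p.1 - k)
  rw [← abs_neg]
  push_cast at this
  convert this using 2
  ring

/-- The reflection formula at `-ν - m`. The sign from shifting the sine by `mπ` cancels `(-1) ^ m`,
so the alternating tail becomes a series with the coefficients of a modified Bessel function. -/
lemma neg_one_pow_mul_Gamma_neg_sub_nat {ν : ℝ} (hν : ∀ j : ℤ, ν + j ≠ 0) (m : ℕ) :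
    (-1) ^ m * Real.Gamma (-ν - m) =
      -(Real.pi / Real.sin (Real.pi * ν)) / Real.Gamma (m + ν + 1) := by
  have h := Real.Gamma_mul_Gamma_one_sub (-ν - m)
  have h1 : (1 : ℝ) - (-ν - m) = m + ν + 1 := by ring
  have h2 : Real.sin (Real.pi * (-ν - m)) = -((-1) ^ m * Real.sin (Real.pi * ν)) := by
    rw [show Real.pi * (-ν - m) = -(Real.pi * ν + m * Real.pi) by ring, Real.sin_neg,
      Real.sin_add_nat_mul_pi]
  have h3 : Real.Gamma (m + ν + 1) ≠ 0 := Real.Gamma_ne_zero fun n hn => by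
    refine hν (m + 1 + n) ?_
    push_cast
    linarith
  rw [h1, h2] at h
  rw [eq_div_iff h3, mul_assoc, h, div_neg, mul_neg, neg_inj]
  rcases neg_one_pow_eq_or ℝ m with h4 | h4 <;> rw [h4]
  · ring
  · rw [neg_one_mul, neg_one_mul, div_neg, neg_neg]

lemma besselTail_eq {ν δ : ℝ} (hδ : 0 < δ) (hν : ∀ j : ℤ, δ ≤ |ν + j|) {y : ℝ} (hy : 0 < y) :
    Summable (fun m : ℕ => (y ^ (2 * m) / (m.factorial * Real.Gamma (m + ν + 1)))) ∧
    besselTail ν y = -(Real.pi / Real.sin (Real.pi * ν)) * y ^ ν *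
        (∑' m : ℕ, y ^ (2 * m) / (m.factorial * Real.Gamma (m + ν + 1)))
      - ∑' p : ℕ × ℕ, (-y) ^ p.1 / p.1.factorial *
          ((-y) ^ p.2 / (p.2.factorial * (-ν - p.1 + p.2))) := by
  have hne : ∀ j : ℤ, ν + j ≠ 0 := fun j hj => by
    have := hν j; rw [hj, abs_zero] at this; linarith
  have hd := summable_besselTail_double hδ hν hy
  have h1 := hasSum_besselTail ν hy
  -- Adding the double series back leaves only the Gamma parts of the incomplete Gamma functions.
  have h2 := h1.add hd.prod.hasSum
  have h3 : HasSum (fun m : ℕ => -(Real.pi / Real.sin (Real.pi * ν)) * y ^ ν *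
      (y ^ (2 * m) / (m.factorial * Real.Gamma (m + ν + 1)))) (besselTail ν y +
      ∑' (m : ℕ) (k : ℕ), (-y) ^ m / m.factorial *
        ((-y) ^ k / (k.factorial * (-ν - m + k)))) := by
    refine h2.congr_fun fun m => ?_
    have hm : ∀ k : ℕ, δ ≤ |-ν - m + k| := fun k => by
      have := hν (m - k)
      rw [← abs_neg]
      push_cast at this
      convert this using 2
      ring
    have h4 := neg_one_pow_mul_Gamma_neg_sub_nat hne m
    simp only
    rw [expIntegral_eq hδ hm hy, tsum_mul_left, ← mul_add, sub_add_cancel,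
      show -(-ν - m) = ν + (m : ℝ) by ring, Real.rpow_add hy, Real.rpow_natCast, neg_pow y m,
      ← div_div]
    calc _ = y ^ ν * (y ^ (2 * m) / m.factorial) *
          (-(Real.pi / Real.sin (Real.pi * ν)) / Real.Gamma (m + ν + 1)) := by ring
      _ = _ := by rw [← h4]; ring
  -- The prefactor must be nonzero to read summability of the bare series off `h3`.
  have hs : Real.sin (Real.pi * ν) ≠ 0 := fun h => by
    obtain ⟨j, hj⟩ := Real.sin_eq_zero_iff.1 h
    have : ν = j := by
      apply mul_left_cancel₀ Real.pi_ne_zero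
      linarith
    exact hne (-j) (by rw [this]; push_cast; ring)
  have hc : -(Real.pi / Real.sin (Real.pi * ν)) * y ^ ν ≠ 0 :=
    mul_ne_zero (neg_ne_zero.2 (div_ne_zero Real.pi_ne_zero hs)) (Real.rpow_pos_of_pos hy _).ne'
  refine ⟨(summable_mul_left_iff hc).1 h3.summable, ?_⟩
  rw [← tsum_mul_left, h3.tsum_eq, hd.tsum_prod]
  ring

/-- Exchanging the two indices and changing the sign of `ν` only changes the sign of the last
denominator. -/
lemma tsum_besselTail_double_neg (ν y : ℝ) :
    ∑' p : ℕ × ℕ, (-y) ^ p.1 / p.1.factorial *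
        ((-y) ^ p.2 / (p.2.factorial * (-(-ν) - p.1 + p.2))) =
      -∑' p : ℕ × ℕ, (-y) ^ p.1 / p.1.factorial *
        ((-y) ^ p.2 / (p.2.factorial * (-ν - p.1 + p.2))) := by
  rw [← (Equiv.prodComm ℕ ℕ).tsum_eq, ← tsum_neg]
  refine tsum_congr fun p => ?_
  simp only [Equiv.prodComm_apply, Prod.fst_swap, Prod.snd_swap]
  rw [← div_div, ← div_div, show - -ν - (p.2 : ℝ) + p.1 = -(-ν - p.1 + p.2) by ring, div_neg]
  ring

/-! ### The Bessel-type integral over the half-line -/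

lemma integrableOn_bessel {ν : ℝ} (hν : ν < 2) {z : ℝ} (hz : 0 < z) :
    IntegrableOn (fun s : ℝ => s ^ (-ν - 1) * Real.exp (-s) * Real.exp (-(z / s)))
      (Set.Ioi 0) := by
  have h := (Real.GammaIntegral_convergent (s := 2 - ν) (by linarith)).const_mul (2 / z ^ 2)
  refine h.mono' ?_ ?_
  · refine ContinuousOn.aestronglyMeasurable ?_ measurableSet_Ioi
    have h0 : ∀ x ∈ Set.Ioi (0 : ℝ), x ≠ 0 := fun x hx => (Set.mem_Ioi.1 hx).ne'
    refine (ContinuousOn.mul ?_ ?_).mul ?_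
    · exact continuousOn_id.rpow_const fun x hx => Or.inl (h0 x hx)
    · fun_prop
    · exact (continuousOn_const.div continuousOn_id h0).neg.rexp
  · refine (ae_restrict_iff' measurableSet_Ioi).2 (ae_of_all _ fun s hs => ?_)
    have hs0 : (0 : ℝ) < s := hs
    rw [Real.norm_of_nonneg (by positivity)]
    -- The quadratic term of the exponential series suffices: a factor `s ^ 2` turns the integrand
    -- into that of `Γ(2 - ν)`.
    have h1 : Real.exp (-(z / s)) ≤ 2 / z ^ 2 * s ^ 2 := by
      have h2 := Real.quadratic_le_exp_of_nonneg (x := z / s) (by positivity)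
      have h3 : (z / s) ^ 2 / 2 ≤ Real.exp (z / s) := by
        have : 0 ≤ z / s := by positivity
        linarith
      rw [Real.exp_neg]
      refine (inv_anti₀ (by positivity) h3).trans_eq ?_
      field_simp
    calc _ ≤ s ^ (-ν - 1) * Real.exp (-s) * (2 / z ^ 2 * s ^ 2) := by gcongr
      _ = 2 / z ^ 2 * (Real.exp (-s) * (s ^ (-ν - 1) * s ^ (2 : ℝ))) := by
        rw [Real.rpow_two]; ring
      _ = _ := by rw [← Real.rpow_add hs0]; ring_nf

/-- The inversion `r ↦ 1 / r` preserves `dr / r`, exchanges the two exponentials and replaces `ν` by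
`-ν`. -/
lemma integral_besselTail_add (ν : ℝ) {y : ℝ}
    (hi : IntegrableOn (fun r : ℝ => r ^ (-ν - 1) * Real.exp (-(y * r)) * Real.exp (-(y / r)))
      (Set.Ioi 0)) :
    ∫ r in Set.Ioi (0 : ℝ), r ^ (-ν - 1) * Real.exp (-(y * r)) * Real.exp (-(y / r)) =
      besselTail ν y + besselTail (-ν) y := by
  have h1 : ∫ r in Set.Ioc (0 : ℝ) 1,
      r ^ (-ν - 1) * Real.exp (-(y * r)) * Real.exp (-(y / r)) = besselTail (-ν) y := by
    -- The change of variables acts on all of `(0, ∞)`, so both pieces are written with indicators;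
    -- inversion sends `(0, 1]` to `[1, ∞)`.
    rw [← Set.Ioi_inter_Iic, ← setIntegral_indicator measurableSet_Iic,
      ← integral_comp_rpow_Ioi _ (neg_ne_zero.2 one_ne_zero), besselTail,
      ← integral_Ici_eq_integral_Ioi (x := (1 : ℝ)),
      ← Set.inter_eq_self_of_subset_right (Set.Ici_subset_Ioi.2 (zero_lt_one (α := ℝ))),
      ← setIntegral_indicator measurableSet_Ici]
    refine setIntegral_congr_fun measurableSet_Ioi fun r hr => ?_
    have hr0 : (0 : ℝ) < r := hr
    simp only [Real.rpow_neg_one]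
    by_cases h : 1 ≤ r
    · rw [Set.indicator_of_mem (show r⁻¹ ∈ Set.Iic (1 : ℝ) from inv_le_one_of_one_le₀ h),
        Set.indicator_of_mem (show r ∈ Set.Ici (1 : ℝ) from h), Real.inv_rpow hr0.le,
        ← Real.rpow_neg hr0.le]
      simp only [abs_neg, abs_one, one_mul, smul_eq_mul, div_inv_eq_mul]
      rw [← div_eq_mul_inv y r, mul_assoc, mul_comm (Real.exp (-(y / r))), ← mul_assoc,
        ← Real.rpow_add hr0, ← mul_assoc]
      ring_nf
    · rw [Set.indicator_of_notMem (s := Set.Iic (1 : ℝ)) (fun h' => h ((inv_le_one₀ hr0).1 h')),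
        Set.indicator_of_notMem (show r ∉ Set.Ici (1 : ℝ) from h), smul_zero]
  rw [← Set.Ioc_union_Ioi_eq_Ioi (zero_le_one (α := ℝ)), setIntegral_union
    (Set.Ioc_disjoint_Ioi le_rfl) measurableSet_Ioi (hi.mono_set Set.Ioc_subset_Ioi_self)
    (hi.mono_set (Set.Ioi_subset_Ioi zero_le_one)), h1, add_comm]
  rfl

lemma integral_bessel_eq {ν : ℝ} (h0 : 0 < ν) (h1 : ν < 1 / 2) {y : ℝ} (hy : 0 < y) :
    ∫ s in Set.Ioi (0 : ℝ), s ^ (-ν - 1) * Real.exp (-s) * Real.exp (-(y ^ 2 / s)) =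
      Real.pi / Real.sin (Real.pi * ν) *
        (y ^ (-(2 * ν)) * (∑' m : ℕ, y ^ (2 * m) / (m.factorial * Real.Gamma (m + -ν + 1)))
          - ∑' m : ℕ, y ^ (2 * m) / (m.factorial * Real.Gamma (m + ν + 1))) := by
  -- For `0 < ν < 1 / 2` the integer nearest to `ν` is `0`, so `δ = ν` serves.
  have hν : ∀ j : ℤ, ν ≤ |ν + j| := fun j => by
    rcases lt_trichotomy j 0 with hj | hj | hj
    · have : (j : ℝ) ≤ -1 := by exact_mod_cast Int.le_sub_one_of_lt hj
      rw [abs_of_nonpos (by linarith)]; linarith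
    · rw [hj, Int.cast_zero, add_zero]; exact le_abs_self ν
    · have : (1 : ℝ) ≤ j := by exact_mod_cast hj
      rw [abs_of_nonneg (by linarith)]; linarith
  have hν' : ∀ j : ℤ, ν ≤ |-ν + j| := fun j => by
    have := hν (-j)
    rw [← abs_neg]
    push_cast at this
    convert this using 2
    ring
  -- The substitution `s = y r` makes the exponent symmetric under inversion.
  have hscale : ∀ r ∈ Set.Ioi (0 : ℝ), (y * r) ^ (-ν - 1) * Real.exp (-(y * r)) *
      Real.exp (-(y ^ 2 / (y * r))) = y ^ (-ν - 1) *
        (r ^ (-ν - 1) * Real.exp (-(y * r)) * Real.exp (-(y / r))) := fun r hr => by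
    have hr0 : (0 : ℝ) < r := hr
    rw [Real.mul_rpow hy.le hr0.le, show y ^ 2 / (y * r) = y / r by field_simp]
    ring
  have hyp := Real.rpow_pos_of_pos hy (-ν - 1)
  have hi : IntegrableOn (fun r : ℝ => r ^ (-ν - 1) * Real.exp (-(y * r)) * Real.exp (-(y / r)))
      (Set.Ioi 0) := by
    have h := integrableOn_bessel (ν := ν) (by linarith) (z := y ^ 2) (by positivity)
    rw [← mul_zero y] at h
    have h2 := ((integrableOn_Ioi_comp_mul_left_iff _ _ hy).2 h).congr_fun hscale measurableSet_Ioi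
    exact (integrable_const_mul_iff hyp.ne'.isUnit _).1 h2
  have h2 := integral_comp_mul_left_Ioi
    (fun s : ℝ => s ^ (-ν - 1) * Real.exp (-s) * Real.exp (-(y ^ 2 / s))) 0 hy
  rw [mul_zero, setIntegral_congr_fun measurableSet_Ioi hscale, integral_const_mul,
    integral_besselTail_add ν hi, smul_eq_mul, eq_inv_mul_iff_mul_eq₀ hy.ne'] at h2
  rw [← h2, (besselTail_eq h0 hν hy).2, (besselTail_eq h0 hν' hy).2, tsum_besselTail_double_neg,
    mul_neg Real.pi ν, Real.sin_neg, div_neg, neg_neg]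
  have e1 : y * y ^ (-ν - 1) = y ^ (-ν) := by
    rw [Real.rpow_sub hy, Real.rpow_one]; field_simp
  have e2 : y ^ (-ν) * y ^ ν = 1 := by rw [← Real.rpow_add hy]; simp
  have e3 : y ^ (-ν) * y ^ (-ν) = y ^ (-(2 * ν)) := by rw [← Real.rpow_add hy]; ring_nf
  rw [← mul_assoc, e1, ← e3]
  linear_combination (-(Real.pi / Real.sin (Real.pi * ν)) *
    ∑' m : ℕ, y ^ (2 * m) / (m.factorial * Real.Gamma (m + ν + 1))) * e2

/-! ### The spectral density of the correlation function `(1 + x²)^(-κ/2)` -/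

/-- The spectral density of `(1 + x²)^(-κ/2)` as a mixture of Gaussian densities. -/
noncomputable def mixtureDensity (κ l : ℝ) : ℝ :=
  (Real.Gamma (κ / 2) * √(4 * Real.pi))⁻¹ *
    ∫ s in Set.Ioi (0 : ℝ), s ^ (-((1 - κ) / 2) - 1) * Real.exp (-s) * Real.exp (-((l / 2) ^ 2 / s))

/-- The `m = 0` term of the first series, multiplied by `Γ((κ + 1) / 2)`, is the `1`; that of the
second is the leading power in `theta`. -/
lemma one_sub_theta {κ : ℝ} (h0 : 0 < κ) (h1 : κ < 1) {u : ℝ} (hu : 0 < u) :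
    1 - theta κ u = Real.Gamma ((κ + 1) / 2) *
      ((∑' m : ℕ, (u / 2) ^ (2 * m) / (m.factorial * Real.Gamma (m + -((1 - κ) / 2) + 1)))
        - (u / 2) ^ (1 - κ) *
          ∑' m : ℕ, (u / 2) ^ (2 * m) / (m.factorial * Real.Gamma (m + (1 - κ) / 2 + 1))) := by
  have hy : 0 < u / 2 := by positivity
  set y := u / 2 with hydef
  have hδ : 0 < (1 - κ) / 2 := by linarith
  have hν : ∀ j : ℤ, (1 - κ) / 2 ≤ |(1 - κ) / 2 + j| := fun j => by
    rcases lt_trichotomy j 0 with hj | hj | hj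
    · have : (j : ℝ) ≤ -1 := by exact_mod_cast Int.le_sub_one_of_lt hj
      rw [abs_of_nonpos (by linarith)]; linarith
    · rw [hj, Int.cast_zero, add_zero]; exact le_abs_self _
    · have : (1 : ℝ) ≤ j := by exact_mod_cast hj
      rw [abs_of_nonneg (by linarith)]; linarith
  have hν' : ∀ j : ℤ, (1 - κ) / 2 ≤ |-((1 - κ) / 2) + j| := fun j => by
    have := hν (-j)
    rw [← abs_neg]
    push_cast at this
    convert this using 2
    ring
  -- Only the summability half of `besselTail_eq` is needed, to split off the terms `m = 0`.
  have s1 := (besselTail_eq hδ hν' hy).1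
  have s2 := (besselTail_eq hδ hν hy).1
  have hG : Real.Gamma ((κ + 1) / 2) ≠ 0 := (Real.Gamma_pos_of_pos (by linarith)).ne'
  rw [s1.tsum_eq_zero_add, s2.tsum_eq_zero_add, theta, ← hydef]
  have t1 : ∀ k : ℕ, y ^ (2 * ((k : ℝ) + 1) + 1 - κ) /
      ((k + 1).factorial * Real.Gamma ((k : ℝ) + 1 - (κ - 1) / 2 + 1)) = y ^ (1 - κ) *
      (y ^ (2 * (k + 1)) / ((k + 1).factorial *
        Real.Gamma (((k + 1 : ℕ) : ℝ) + (1 - κ) / 2 + 1))) := fun k => by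
    rw [show 2 * ((k : ℝ) + 1) + 1 - κ = (1 - κ) + ((2 * (k + 1) : ℕ) : ℝ) by push_cast; ring,
      Real.rpow_add hy, Real.rpow_natCast,
      show (k : ℝ) + 1 - (κ - 1) / 2 + 1 = ((k + 1 : ℕ) : ℝ) + (1 - κ) / 2 + 1 by push_cast; ring]
    ring
  have t2 : ∀ k : ℕ, y ^ (2 * (k + 1)) /
      ((k + 1).factorial * Real.Gamma ((k : ℝ) + 1 + (κ - 1) / 2 + 1)) =
      y ^ (2 * (k + 1)) / ((k + 1).factorial *
        Real.Gamma (((k + 1 : ℕ) : ℝ) + -((1 - κ) / 2) + 1)) := fun k => by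
    rw [show (k : ℝ) + 1 + (κ - 1) / 2 + 1 = ((k + 1 : ℕ) : ℝ) + -((1 - κ) / 2) + 1 by
      push_cast; ring]
  simp_rw [t1, t2, tsum_mul_left]
  simp only [mul_zero, pow_zero, Nat.factorial_zero, Nat.cast_one, one_mul, Nat.cast_zero,
    zero_add]
  rw [show (3 - κ) / 2 = (1 - κ) / 2 + 1 by ring, show -((1 - κ) / 2) + 1 = (κ + 1) / 2 by ring]
  generalize (∑' k : ℕ, y ^ (2 * (k + 1)) / ((k + 1).factorial *
        Real.Gamma (((k + 1 : ℕ) : ℝ) + -((1 - κ) / 2) + 1))) = A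
  generalize (∑' k : ℕ, y ^ (2 * (k + 1)) / ((k + 1).factorial *
        Real.Gamma (((k + 1 : ℕ) : ℝ) + (1 - κ) / 2 + 1))) = B
  field_simp
  ring

lemma mixtureDensity_eq {κ : ℝ} (h0 : 0 < κ) (h1 : κ < 1) {l : ℝ} (hl : l ≠ 0) :
    mixtureDensity κ l = cTwo κ * ((1 - theta κ |l|) / |l| ^ (1 - κ)) := by
  have hu : 0 < |l| := abs_pos.2 hl
  have hy : 0 < |l| / 2 := by positivity
  rw [one_sub_theta h0 h1 hu, mixtureDensity, ← sq_abs (l / 2), abs_div, abs_two,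
    integral_bessel_eq (by linarith) (by linarith) hy, cTwo]
  generalize (∑' m : ℕ, (|l| / 2) ^ (2 * m) / (m.factorial *
    Real.Gamma (m + -((1 - κ) / 2) + 1))) = A
  generalize (∑' m : ℕ, (|l| / 2) ^ (2 * m) / (m.factorial *
    Real.Gamma (m + (1 - κ) / 2 + 1))) = B
  have e1 : Real.sin (Real.pi * ((1 - κ) / 2)) = Real.cos (κ * Real.pi / 2) := by
    rw [← Real.sin_pi_div_two_sub]; ring_nf
  have hcos : 0 < Real.cos (κ * Real.pi / 2) := by
    apply Real.cos_pos_of_mem_Ioo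
    constructor <;> nlinarith [Real.pi_pos]
  -- Legendre duplication converts `Γ(κ/2)` and `Γ((κ+1)/2)` into the `Γ(κ)` of `cTwo`; the cosine
  -- comes from the sine through `e1`.
  have e2 := Real.Gamma_mul_Gamma_add_half (κ / 2)
  rw [show κ / 2 + 1 / 2 = (κ + 1) / 2 by ring, show 2 * (κ / 2) = κ by ring] at e2
  have hG1 : 0 < Real.Gamma ((κ + 1) / 2) := Real.Gamma_pos_of_pos (by linarith)
  have hG2 : 0 < Real.Gamma (κ / 2) := Real.Gamma_pos_of_pos (by linarith)
  have hG3 : 0 < Real.Gamma κ := Real.Gamma_pos_of_pos (by linarith)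
  have e3 : (|l| / 2) ^ (-(2 * ((1 - κ) / 2))) = ((|l| / 2) ^ (1 - κ))⁻¹ := by
    rw [← Real.rpow_neg hy.le]; ring_nf
  have e4 : |l| ^ (1 - κ) = 2 ^ (1 - κ) * (|l| / 2) ^ (1 - κ) := by
    rw [← Real.mul_rpow zero_le_two hy.le, mul_div_cancel₀ _ two_ne_zero]
  have e5 : √(4 * Real.pi) = 2 * √Real.pi := by
    rw [Real.sqrt_mul (by norm_num), show (4 : ℝ) = 2 ^ 2 by norm_num, Real.sqrt_sq zero_le_two]
  rw [e1, e3, e4, e5]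
  have h2 : (0 : ℝ) < 2 ^ (1 - κ) := by positivity
  have h3 : 0 < (|l| / 2) ^ (1 - κ) := by positivity
  have h4 := Real.sqrt_pos.2 Real.pi_pos
  have h5 := Real.sq_sqrt Real.pi_pos.le
  generalize (|l| / 2) ^ (1 - κ) = t at *
  generalize (2 : ℝ) ^ (1 - κ) = q at *
  generalize Real.Gamma ((κ + 1) / 2) = g1 at *
  generalize Real.Gamma (κ / 2) = g2 at *
  generalize Real.Gamma κ = g3 at *
  generalize Real.cos (κ * Real.pi / 2) = c at *
  generalize √Real.pi = p at *
  rw [← h5]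
  field_simp
  linear_combination (-(A - t * B)) * e2

lemma mixtureDensity_pos {κ : ℝ} (h0 : 0 < κ) {l : ℝ} (hl : l ≠ 0) :
    0 < mixtureDensity κ l := by
  have hG2 : 0 < Real.Gamma (κ / 2) := Real.Gamma_pos_of_pos (by linarith)
  have hp := Real.sqrt_pos.2 (mul_pos four_pos Real.pi_pos)
  refine mul_pos (by positivity) ?_
  have hz : 0 < (l / 2) ^ 2 := by positivity
  rw [setIntegral_pos_iff_support_of_nonneg_ae _
    (integrableOn_bessel (ν := (1 - κ) / 2) (by linarith) hz)]
  · rw [Set.inter_eq_self_of_subset_right]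
    · simp
    · intro s hs
      have hs0 : (0 : ℝ) < s := hs
      rw [Function.mem_support]
      positivity
  · refine (ae_restrict_iff' measurableSet_Ioi).2 (ae_of_all _ fun s hs => ?_)
    have hs0 : (0 : ℝ) < s := hs
    simp only [Pi.zero_apply]
    positivity

lemma mixtureDensity_nonneg {κ : ℝ} (h0 : 0 < κ) (l : ℝ) : 0 ≤ mixtureDensity κ l := by
  have hG2 : 0 < Real.Gamma (κ / 2) := Real.Gamma_pos_of_pos (by linarith)
  refine mul_nonneg (by positivity) (setIntegral_nonneg measurableSet_Ioi fun s hs => ?_)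
  have hs0 : (0 : ℝ) < s := hs
  positivity

/-- Each Gaussian in the mixture decreases in `|l|`. This bounds the density away from its
singularity at `0`. -/
lemma mixtureDensity_le_of_abs_le {κ : ℝ} (h0 : 0 < κ) {a l : ℝ} (ha : 0 < a) (hl : a ≤ |l|) :
    mixtureDensity κ l ≤ mixtureDensity κ a := by
  have hG2 : 0 < Real.Gamma (κ / 2) := Real.Gamma_pos_of_pos (by linarith)
  have hl0 : l ≠ 0 := abs_pos.1 (ha.trans_le hl)
  refine mul_le_mul_of_nonneg_left (setIntegral_mono_on
    (integrableOn_bessel (ν := (1 - κ) / 2) (by linarith) (by positivity))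
    (integrableOn_bessel (ν := (1 - κ) / 2) (by linarith) (by positivity))
    measurableSet_Ioi fun s hs => ?_) (by positivity)
  have hs0 : (0 : ℝ) < s := hs
  have : (a / 2) ^ 2 ≤ (l / 2) ^ 2 := by
    rw [div_pow, div_pow, ← sq_abs l]
    gcongr
  gcongr

lemma continuousAt_mixtureDensity {κ : ℝ} (h0 : 0 < κ) {l : ℝ} (hl : l ≠ 0) :
    ContinuousAt (mixtureDensity κ) l := by
  have ha : 0 < |l| / 2 := by positivity
  refine ContinuousAt.mul continuousAt_const ?_
  refine continuousAt_of_dominated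
    (bound := fun s : ℝ => s ^ (-((1 - κ) / 2) - 1) * Real.exp (-s) *
      Real.exp (-((|l| / 2 / 2) ^ 2 / s))) ?_ ?_
    (integrableOn_bessel (ν := (1 - κ) / 2) (by linarith) (by positivity)) ?_
  · exact Eventually.of_forall fun x => Measurable.aestronglyMeasurable (by fun_prop)
  · have : ∀ᶠ x in 𝓝 l, |l| / 2 < |x| :=
      continuous_abs.continuousAt.eventually (lt_mem_nhds (by linarith))
    filter_upwards [this] with x hx
    refine (ae_restrict_iff' measurableSet_Ioi).2 (ae_of_all _ fun s hs => ?_)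
    have hs0 : (0 : ℝ) < s := hs
    rw [Real.norm_of_nonneg (by positivity), ← sq_abs (x / 2), abs_div, abs_two]
    gcongr
  · refine ae_of_all _ fun s => ?_
    fun_prop

/-- Integrating the modulus in `l` first yields a factor `√(4πs)`, which raises the exponent of `s`
to `κ / 2 - 1` and leaves the convergent integral of `Γ(κ / 2)`. -/
lemma integrable_prod_mixture {κ : ℝ} (h0 : 0 < κ) (x : ℝ) :
    Integrable (Function.uncurry fun l s : ℝ =>
      ((s ^ (-((1 - κ) / 2) - 1) * Real.exp (-s) * Real.exp (-((l / 2) ^ 2 / s)) : ℝ) : ℂ) *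
        Complex.exp (Complex.I * x * l)) (volume.prod (volume.restrict (Set.Ioi 0))) := by
  have hm : Measurable (Function.uncurry fun l s : ℝ =>
      ((s ^ (-((1 - κ) / 2) - 1) * Real.exp (-s) * Real.exp (-((l / 2) ^ 2 / s)) : ℝ) : ℂ) *
        Complex.exp (Complex.I * x * l)) := by
    unfold Function.uncurry; fun_prop
  have hexp : ∀ l : ℝ, ‖Complex.exp (Complex.I * x * l)‖ = 1 := fun l => by
    rw [show Complex.I * x * l = ((x * l : ℝ) : ℂ) * Complex.I by push_cast; ring,
      Complex.norm_exp_ofReal_mul_I]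
  have hnorm : ∀ s ∈ Set.Ioi (0 : ℝ), ∀ l : ℝ, ‖((s ^ (-((1 - κ) / 2) - 1) * Real.exp (-s) *
      Real.exp (-((l / 2) ^ 2 / s)) : ℝ) : ℂ) * Complex.exp (Complex.I * x * l)‖ =
      s ^ (-((1 - κ) / 2) - 1) * Real.exp (-s) * Real.exp (-(4 * s)⁻¹ * l ^ 2) := by
    intro s hs l
    have hs0 : (0 : ℝ) < s := hs
    rw [norm_mul, hexp, mul_one, Complex.norm_real, Real.norm_of_nonneg (by positivity)]
    congr 2
    field_simp
    ring
  refine (integrable_prod_iff' hm.aestronglyMeasurable).2 ⟨?_, ?_⟩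
  · refine (ae_restrict_iff' measurableSet_Ioi).2 (ae_of_all _ fun s hs => ?_)
    have hs0 : (0 : ℝ) < s := hs
    refine ((integrable_exp_neg_mul_sq (b := (4 * s)⁻¹) (by positivity)).const_mul
      (s ^ (-((1 - κ) / 2) - 1) * Real.exp (-s))).mono'
      (hm.comp measurable_prodMk_right).aestronglyMeasurable (ae_of_all _ fun l => ?_)
    exact (hnorm s hs l).le
  · have h := (Real.GammaIntegral_convergent (s := κ / 2) (by linarith)).const_mul
      (√(4 * Real.pi))
    refine IntegrableOn.congr_fun h (fun s hs => ?_) measurableSet_Ioi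
    have hs0 : (0 : ℝ) < s := hs
    simp only [Function.uncurry_apply_pair]
    rw [integral_congr_ae (ae_of_all _ (hnorm s hs)), integral_const_mul, integral_gaussian,
      div_inv_eq_mul, show Real.pi * (4 * s) = 4 * Real.pi * s by ring,
      Real.sqrt_mul (x := 4 * Real.pi) (by positivity), Real.sqrt_eq_rpow s,
      show κ / 2 - 1 = -((1 - κ) / 2) - 1 + 1 / 2 by ring, Real.rpow_add hs0]
    ring

/-- The Gaussian of variance `2s` has transform proportional to `exp (-x² s)`, which joins `exp
(-s)` to form `exp (-(1 + x²) s)`. -/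
lemma integral_exp_mul_mixture_aux {κ : ℝ} (x : ℝ) {s : ℝ} (hs : 0 < s) :
    ∫ l : ℝ, ((s ^ (-((1 - κ) / 2) - 1) * Real.exp (-s) * Real.exp (-((l / 2) ^ 2 / s)) : ℝ) : ℂ) *
        Complex.exp (Complex.I * x * l) =
      ((√(4 * Real.pi) * (s ^ (κ / 2 - 1) * Real.exp (-((1 + x ^ 2) * s))) : ℝ) : ℂ) := by
  have h := fourierIntegral_gaussian (b := ((4 * s)⁻¹ : ℝ))
    (by rw [Complex.ofReal_re]; positivity) x
  have e1 : ∀ l : ℝ, ((s ^ (-((1 - κ) / 2) - 1) * Real.exp (-s) *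
      Real.exp (-((l / 2) ^ 2 / s)) : ℝ) : ℂ) * Complex.exp (Complex.I * x * l) =
      ((s ^ (-((1 - κ) / 2) - 1) * Real.exp (-s) : ℝ) : ℂ) *
        (Complex.exp (Complex.I * x * l) * Complex.exp (-((4 * s)⁻¹ : ℝ) * l ^ 2)) := fun l => by
    have : Complex.exp (-((4 * s)⁻¹ : ℝ) * l ^ 2) =
        ((Real.exp (-((l / 2) ^ 2 / s)) : ℝ) : ℂ) := by
      rw [Complex.ofReal_exp]
      congr 1
      push_cast
      have : (s : ℂ) ≠ 0 := by exact_mod_cast hs.ne'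
      field_simp
      ring
    rw [this]
    push_cast
    ring
  simp_rw [e1]
  rw [integral_const_mul, h]
  have e2 : ((Real.pi : ℂ) / ((4 * s)⁻¹ : ℝ)) ^ (1 / 2 : ℂ) =
      ((√(4 * Real.pi) * s ^ (1 / 2 : ℝ) : ℝ) : ℂ) := by
    rw [← Complex.ofReal_div, div_inv_eq_mul, show (1 / 2 : ℂ) = ((1 / 2 : ℝ) : ℂ) by push_cast; rfl,
      ← Complex.ofReal_cpow (by positivity), Real.sqrt_eq_rpow,
      ← Real.mul_rpow (by positivity) hs.le]
    ring_nf
  have e3 : Complex.exp (-(x : ℂ) ^ 2 / (4 * ((4 * s)⁻¹ : ℝ))) =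
      ((Real.exp (-(x ^ 2 * s)) : ℝ) : ℂ) := by
    rw [Complex.ofReal_exp]
    congr 1
    push_cast
    have : (s : ℂ) ≠ 0 := by exact_mod_cast hs.ne'
    field_simp
  rw [e2, e3, ← Complex.ofReal_mul, ← Complex.ofReal_mul, Complex.ofReal_inj,
    show κ / 2 - 1 = -((1 - κ) / 2) - 1 + 1 / 2 by ring, Real.rpow_add hs,
    show -((1 + x ^ 2) * s) = -s + -(x ^ 2 * s) by ring, Real.exp_add]
  ring

lemma integrable_mixtureDensity {κ : ℝ} (h0 : 0 < κ) : Integrable (mixtureDensity κ) := by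
  have h := (integrable_prod_mixture h0 0).integral_prod_left.re
  refine Integrable.const_mul (h.congr (ae_of_all _ fun l => ?_)) _
  simp only [Function.uncurry_apply_pair, Complex.ofReal_zero, mul_zero, zero_mul,
    Complex.exp_zero, mul_one]
  rw [integral_complex_ofReal]
  simp

lemma integral_exp_mul_mixtureDensity {κ : ℝ} (h0 : 0 < κ) (x : ℝ) :
    ∫ l : ℝ, (mixtureDensity κ l : ℂ) * Complex.exp (Complex.I * x * l) =
      (((1 + x ^ 2) ^ (κ / 2))⁻¹ : ℝ) := by
  have hG2 : 0 < Real.Gamma (κ / 2) := Real.Gamma_pos_of_pos (by linarith)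
  have hp := Real.sqrt_pos.2 (mul_pos four_pos Real.pi_pos)
  have hx : 0 < 1 + x ^ 2 := by positivity
  have h1 := integral_integral_swap (integrable_prod_mixture h0 x)
  rw [setIntegral_congr_fun measurableSet_Ioi fun s hs => integral_exp_mul_mixture_aux x hs,
    integral_complex_ofReal, integral_const_mul,
    Real.integral_rpow_mul_exp_neg_mul_Ioi (by linarith) hx] at h1
  simp_rw [integral_mul_const, integral_complex_ofReal] at h1
  simp_rw [mixtureDensity, Complex.ofReal_mul, mul_assoc]
  rw [integral_const_mul]
  simp_rw [mul_assoc] at h1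
  rw [h1, ← Complex.ofReal_mul, Complex.ofReal_inj, one_div, Real.inv_rpow hx.le]
  field_simp

/-! ### The spectral density `specDensity` -/

lemma specDensity_eq {κ w l : ℝ} (h0 : 0 < κ) (h1 : κ < 1) (hl : l + w ≠ 0) (hl' : l - w ≠ 0) :
    specDensity κ w l = (mixtureDensity κ (l + w) + mixtureDensity κ (l - w)) / 2 := by
  rw [mixtureDensity_eq h0 h1 hl, mixtureDensity_eq h0 h1 hl', specDensity]
  ring

/-- The two exceptional points are the singularities `±w`. -/
lemma specDensity_ae_eq {κ : ℝ} (w : ℝ) (h0 : 0 < κ) (h1 : κ < 1) :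
    specDensity κ w =ᵐ[volume]
      fun l => (mixtureDensity κ (l + w) + mixtureDensity κ (l - w)) / 2 := by
  have h : ∀ᵐ l : ℝ, l ∉ ({-w, w} : Set ℝ) :=
    measure_eq_zero_iff_ae_notMem.1 ((Set.toFinite _).measure_zero _)
  filter_upwards [h] with l hl
  refine specDensity_eq h0 h1 (fun h => hl ?_) (fun h => hl ?_)
  · exact Or.inl (by linarith)
  · exact Or.inr (by rw [Set.mem_singleton_iff]; linarith)

lemma mixtureDensity_neg (κ l : ℝ) : mixtureDensity κ (-l) = mixtureDensity κ l := by
  simp only [mixtureDensity, neg_div, even_two.neg_pow]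

lemma limitVariance_eq {κ w : ℝ} (h0 : 0 < κ) (h1 : κ < 1) (hw : w ≠ 0) :
    cTwo κ / |w| ^ (1 - κ) * (1 - theta κ |w|) = mixtureDensity κ w := by
  rw [mixtureDensity_eq h0 h1 hw]
  ring

lemma integrable_specDensity {κ : ℝ} (w : ℝ) (h0 : 0 < κ) (h1 : κ < 1) :
    Integrable (specDensity κ w) := by
  have h := integrable_mixtureDensity h0
  exact (((h.comp_add_right w).add (h.comp_sub_right w)).div_const 2).congr
    (specDensity_ae_eq w h0 h1).symm

lemma specDensity_nonneg_ae {κ : ℝ} (w : ℝ) (h0 : 0 < κ) (h1 : κ < 1) :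
    ∀ᵐ l : ℝ, 0 ≤ specDensity κ w l := by
  filter_upwards [specDensity_ae_eq w h0 h1] with l hl
  rw [hl]
  have := mixtureDensity_nonneg h0 (l + w)
  have := mixtureDensity_nonneg h0 (l - w)
  positivity

/-- For such `l` both `l + w` and `l - w` stay at distance at least `|w| / 2` from the singularity
of `mixtureDensity`. -/
lemma specDensity_of_abs_le {κ w l : ℝ} (h0 : 0 < κ) (h1 : κ < 1) (hw : w ≠ 0)
    (hl : |l| ≤ |w| / 2) :
    specDensity κ w l = (mixtureDensity κ (l + w) + mixtureDensity κ (l - w)) / 2 ∧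
      specDensity κ w l ≤ mixtureDensity κ (|w| / 2) := by
  have hw0 : 0 < |w| := abs_pos.2 hw
  have e1 : |w| / 2 ≤ |l + w| := by
    have := abs_sub_abs_le_abs_sub w (-l)
    rw [abs_neg, sub_neg_eq_add, add_comm w l] at this
    linarith
  have e2 : |w| / 2 ≤ |l - w| := by
    have := abs_sub_abs_le_abs_sub w l
    rw [abs_sub_comm] at this
    linarith
  have h := specDensity_eq h0 h1 (l := l) (w := w) (abs_pos.1 (by linarith))
    (abs_pos.1 (by linarith))
  refine ⟨h, ?_⟩
  rw [h]
  have := mixtureDensity_le_of_abs_le h0 (half_pos hw0) e1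
  have := mixtureDensity_le_of_abs_le h0 (half_pos hw0) e2
  linarith

lemma tendsto_specDensity {κ w : ℝ} (h0 : 0 < κ) (h1 : κ < 1) (hw : w ≠ 0) :
    Tendsto (specDensity κ w) (𝓝 0) (𝓝 (mixtureDensity κ w)) := by
  have hw0 : 0 < |w| := abs_pos.2 hw
  have h2 : Tendsto (fun l => (mixtureDensity κ (l + w) + mixtureDensity κ (l - w)) / 2) (𝓝 0)
      (𝓝 ((mixtureDensity κ w + mixtureDensity κ (-w)) / 2)) := by
    refine Tendsto.div_const (Tendsto.add ?_ ?_) 2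
    · refine (continuousAt_mixtureDensity h0 hw).tendsto.comp ?_
      exact (continuous_add_const w).tendsto' _ _ (zero_add w)
    · refine (continuousAt_mixtureDensity h0 (neg_ne_zero.2 hw)).tendsto.comp ?_
      exact (continuous_sub_right w).tendsto' _ _ (zero_sub w)
  rw [mixtureDensity_neg, add_self_div_two] at h2
  refine h2.congr' ?_
  have : ∀ᶠ l : ℝ in 𝓝 0, |l| < |w| / 2 :=
    continuous_abs.continuousAt.eventually (gt_mem_nhds (by rw [abs_zero]; positivity))
  filter_upwards [this] with l hl
  exact (specDensity_of_abs_le h0 h1 hw hl.le).1.symm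

/-- Translations by `±w` become phases `exp (∓ iwx)` after Fourier transform, and their mean is `cos
(wx)`. -/
lemma integral_exp_mul_specDensity {κ : ℝ} (w : ℝ) (h0 : 0 < κ) (h1 : κ < 1) (x : ℝ) :
    ∫ l : ℝ, (specDensity κ w l : ℂ) * Complex.exp (Complex.I * x * l) =
      ((Real.cos (w * x) / (1 + x ^ 2) ^ (κ / 2) : ℝ) : ℂ) := by
  set G : ℝ → ℂ := fun l => (mixtureDensity κ l : ℂ) * Complex.exp (Complex.I * x * l) with hG
  have hGi : Integrable G := by
    refine (integrable_mixtureDensity h0).ofReal.mul_bdd (c := 1) ?_ (ae_of_all _ fun l => ?_)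
    · exact Continuous.aestronglyMeasurable (by fun_prop)
    · rw [show Complex.I * x * l = ((x * l : ℝ) : ℂ) * Complex.I by push_cast; ring,
        Complex.norm_exp_ofReal_mul_I]
  have e : ∀ᵐ l : ℝ, (specDensity κ w l : ℂ) * Complex.exp (Complex.I * x * l) =
      Complex.exp (-(w * x : ℝ) * Complex.I) / 2 * G (l + w) +
        Complex.exp ((w * x : ℝ) * Complex.I) / 2 * G (l - w) := by
    filter_upwards [specDensity_ae_eq w h0 h1] with l hl
    rw [hl]
    have e1 : Complex.exp (Complex.I * x * l) = Complex.exp (-(w * x : ℝ) * Complex.I) *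
        Complex.exp (Complex.I * x * (l + w : ℝ)) := by
      rw [← Complex.exp_add]; congr 1; push_cast; ring
    have e2 : Complex.exp (Complex.I * x * l) = Complex.exp ((w * x : ℝ) * Complex.I) *
        Complex.exp (Complex.I * x * (l - w : ℝ)) := by
      rw [← Complex.exp_add]; congr 1; push_cast; ring
    simp only [hG]
    rw [show ∀ a b p q r s : ℂ, p / 2 * (a * q) + r / 2 * (b * s) =
      (a * (p * q) + b * (r * s)) / 2 by intros; ring, ← e1, ← e2]
    push_cast
    ring
  rw [integral_congr_ae e, integral_add ((hGi.comp_add_right w).const_mul _)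
    ((hGi.comp_sub_right w).const_mul _), integral_const_mul, integral_const_mul,
    integral_add_right_eq_self G w, integral_sub_right_eq_self G w, hG,
    integral_exp_mul_mixtureDensity h0 x, Complex.ofReal_div, Complex.ofReal_cos, Complex.cos]
  push_cast
  ring

lemma isFiniteMeasure_withDensity_specDensity {κ : ℝ} (w : ℝ) (h0 : 0 < κ) (h1 : κ < 1) :
    IsFiniteMeasure (volume.withDensity fun l => ENNReal.ofReal (specDensity κ w l)) :=
  isFiniteMeasure_withDensity_ofReal (integrable_specDensity w h0 h1).2

lemma integral_withDensity_specDensity {κ : ℝ} (w : ℝ) (h0 : 0 < κ) (h1 : κ < 1) (g : ℝ → ℂ) :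
    ∫ l, g l ∂(volume.withDensity fun l => ENNReal.ofReal (specDensity κ w l)) =
      ∫ l, (specDensity κ w l : ℂ) * g l := by
  rw [integral_withDensity_eq_integral_toReal_smul₀
    (integrable_specDensity w h0 h1).1.aemeasurable.ennreal_ofReal
    (ae_of_all _ fun _ => ENNReal.ofReal_lt_top)]
  refine integral_congr_ae ?_
  filter_upwards [specDensity_nonneg_ae w h0 h1] with l hl
  rw [ENNReal.toReal_ofReal hl, Complex.real_smul]

lemma charFun_withDensity_specDensity {κ : ℝ} (w : ℝ) (h0 : 0 < κ) (h1 : κ < 1) (x : ℝ) :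
    charFun (volume.withDensity fun l => ENNReal.ofReal (specDensity κ w l)) x =
      ((Real.cos (w * x) / (1 + x ^ 2) ^ (κ / 2) : ℝ) : ℂ) := by
  rw [charFun_apply_real, integral_withDensity_specDensity w h0 h1,
    ← integral_exp_mul_specDensity w h0 h1 x]
  congr with l
  congr 2
  ring

/-! ### The heat kernel and the scaled spectral density in `L²` -/

lemma norm_heatKernelFourier (μ t x l : ℝ) :
    ‖heatKernelFourier μ t x l‖ = Real.exp (-(μ * t * l ^ 2)) := by
  rw [heatKernelFourier, show Complex.I * l * x - μ * t * l ^ 2 =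
    ((-(μ * t * l ^ 2) : ℝ) : ℂ) + ((l * x : ℝ) : ℂ) * Complex.I by push_cast; ring,
    Complex.exp_add, norm_mul, Complex.norm_exp_ofReal_mul_I, mul_one, ← Complex.ofReal_exp,
    Complex.norm_real, Real.norm_of_nonneg (Real.exp_nonneg _)]

lemma continuous_heatKernelFourier (μ t x : ℝ) : Continuous (heatKernelFourier μ t x) := by
  unfold heatKernelFourier; fun_prop

lemma norm_heatKernelFourier_le_one {μ t : ℝ} (hμ : 0 ≤ μ) (ht : 0 ≤ t) (x l : ℝ) :
    ‖heatKernelFourier μ t x l‖ ≤ 1 := by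
  rw [norm_heatKernelFourier, Real.exp_le_one_iff, neg_nonpos]
  positivity

lemma conj_heatKernelFourier_neg (μ t x l : ℝ) :
    (starRingEnd ℂ) (heatKernelFourier μ t x (-l)) = heatKernelFourier μ t x l := by
  rw [heatKernelFourier, heatKernelFourier, ← Complex.exp_conj]
  congr 1
  simp

lemma memLp_heatKernelFourier_of_isFiniteMeasure {F : Measure ℝ} [IsFiniteMeasure F] {μ t : ℝ}
    (hμ : 0 ≤ μ) (ht : 0 ≤ t) (x : ℝ) : MemLp (heatKernelFourier μ t x) 2 F :=
  .of_bound (continuous_heatKernelFourier μ t x).aestronglyMeasurable 1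
    (ae_of_all _ fun l => norm_heatKernelFourier_le_one hμ ht x l)

lemma memLp_heatKernelFourier {μ t : ℝ} (hμ : 0 < μ) (ht : 0 < t) (x : ℝ) :
    MemLp (heatKernelFourier μ t x) 2 volume := by
  rw [memLp_two_iff_integrable_sq_norm (continuous_heatKernelFourier μ t x).aestronglyMeasurable]
  refine (integrable_exp_neg_mul_sq (b := 2 * μ * t) (by positivity)).congr
    (ae_of_all _ fun l => ?_)
  simp only [norm_heatKernelFourier]
  rw [← Real.exp_nat_mul]
  congr 1
  push_cast
  ring

lemma integrable_scaled_specDensity {κ : ℝ} (w : ℝ) (h0 : 0 < κ) (h1 : κ < 1) {ε : ℝ}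
    (hε : 0 < ε) : Integrable fun l => specDensity κ w (l * √ε) :=
  (integrable_specDensity w h0 h1).comp_mul_right' (Real.sqrt_pos.2 hε).ne'

lemma scaled_specDensity_nonneg_ae {κ : ℝ} (w : ℝ) (h0 : 0 < κ) (h1 : κ < 1) {ε : ℝ}
    (hε : 0 < ε) : ∀ᵐ l : ℝ, 0 ≤ specDensity κ w (l * √ε) := by
  have h : ∀ᵐ l : ℝ, l ∉ ({-w / √ε, w / √ε} : Set ℝ) :=
    measure_eq_zero_iff_ae_notMem.1 ((Set.toFinite _).measure_zero _)
  have hs := (Real.sqrt_pos.2 hε).ne'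
  filter_upwards [h] with l hl
  have := mixtureDensity_nonneg h0 (l * √ε + w)
  have := mixtureDensity_nonneg h0 (l * √ε - w)
  rw [specDensity_eq h0 h1 (fun h => hl (Or.inl ?_)) (fun h => hl (Or.inr ?_))]
  · positivity
  · rw [eq_div_iff hs]; linarith
  · rw [Set.mem_singleton_iff, eq_div_iff hs]; linarith

lemma memLp_heatKernelFourier_mul_sqrt_specDensity {κ : ℝ} (w : ℝ) (h0 : 0 < κ) (h1 : κ < 1)
    {μ t : ℝ} (hμ : 0 < μ) (ht : 0 < t) (x : ℝ) {ε : ℝ} (hε : 0 < ε) :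
    MemLp (fun l => heatKernelFourier μ t x l * (√(specDensity κ w (l * √ε)) : ℝ)) 2 volume := by
  have hi := integrable_scaled_specDensity w h0 h1 hε
  have hm : AEStronglyMeasurable (fun l => heatKernelFourier μ t x l *
      (√(specDensity κ w (l * √ε)) : ℝ)) volume :=
    (continuous_heatKernelFourier μ t x).aestronglyMeasurable.mul
      (Complex.continuous_ofReal.comp Real.continuous_sqrt
        |>.comp_aestronglyMeasurable hi.aestronglyMeasurable)
  rw [memLp_two_iff_integrable_sq_norm hm]
  refine hi.mono' (hm.norm.pow 2) ?_
  filter_upwards [scaled_specDensity_nonneg_ae w h0 h1 hε] with l hl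
  rw [norm_mul, mul_pow, Complex.norm_real, norm_mul, norm_pow, norm_pow, norm_norm, norm_norm,
    Real.norm_of_nonneg (Real.sqrt_nonneg _), Real.sq_sqrt hl]
  exact mul_le_of_le_one_left hl (pow_le_one₀ (norm_nonneg _)
    (norm_heatKernelFourier_le_one hμ.le ht.le x l))

/-- Dominated convergence does not apply directly, because the singularities at `±w/√ε` move with
`ε`. The density is truncated at a level `M` that is inactive for `|l√ε| ≤ |w|/2`. Outside this
region half of the Gaussian weight is at most `ε / c`, which beats the factor `1/√ε` in the integral
of the scaled density. -/
lemma tendsto_integral_scaled_specDensity {κ w : ℝ} (h0 : 0 < κ) (h1 : κ < 1) (hw : w ≠ 0)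
    {b : ℝ} (hb : 0 < b) :
    Tendsto (fun ε : ℝ => ∫ l, Real.exp (-(2 * b) * l ^ 2) *
      (√(specDensity κ w (l * √ε)) - √(mixtureDensity κ w)) ^ 2) (𝓝[>] 0) (𝓝 0) := by
  set m := mixtureDensity κ w with hm
  -- `M` exceeds both the bound on the density near `0` and the limit `m`, so truncation changes
  -- neither.
  set M := mixtureDensity κ (|w| / 2) + m with hM
  have hw0 : 0 < |w| := abs_pos.2 hw
  have hm0 : 0 < m := mixtureDensity_pos h0 hw
  have hM0 : 0 < M := add_pos (mixtureDensity_pos h0 (half_pos hw0).ne') hm0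
  -- Chosen so that `|l√ε| > |w| / 2` forces `b * l ^ 2 ≥ c / ε`.
  set c := b * (|w| / 2) ^ 2 with hc
  have hc0 : 0 < c := by positivity
  have hsq : ∀ a d : ℝ, 0 ≤ a → 0 ≤ d → (√a - √d) ^ 2 ≤ a + d := fun a d ha hd => by
    have h1 := Real.sq_sqrt ha
    have h2 := Real.sq_sqrt hd
    nlinarith [Real.sqrt_nonneg a, Real.sqrt_nonneg d,
      mul_nonneg (Real.sqrt_nonneg a) (Real.sqrt_nonneg d)]
  set I := ∫ l, specDensity κ w l with hI
  set J := ∫ l : ℝ, Real.exp (-b * l ^ 2) with hJ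
  have hgauss := integrable_exp_neg_mul_sq hb
  have hgauss2 := integrable_exp_neg_mul_sq (b := 2 * b) (by positivity)
  -- the truncated part
  have hT : Tendsto (fun ε : ℝ => ∫ l, Real.exp (-(2 * b) * l ^ 2) *
      (√(min (specDensity κ w (l * √ε)) M) - √m) ^ 2) (𝓝[>] 0) (𝓝 (∫ l : ℝ, 0)) := by
    refine tendsto_integral_filter_of_dominated_convergence
      (fun l => Real.exp (-(2 * b) * l ^ 2) * (M + m)) ?_ ?_ (hgauss2.mul_const _) ?_
    · filter_upwards [self_mem_nhdsWithin] with ε hε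
      have hi := (integrable_scaled_specDensity w h0 h1 hε).aestronglyMeasurable
      refine (Continuous.aestronglyMeasurable (by fun_prop)).mul ?_
      have : Continuous fun a : ℝ => (√(min a M) - √m) ^ 2 := by fun_prop
      exact this.comp_aestronglyMeasurable hi
    · filter_upwards [self_mem_nhdsWithin] with ε hε
      filter_upwards [scaled_specDensity_nonneg_ae w h0 h1 hε] with l hl
      rw [Real.norm_of_nonneg (by positivity)]
      gcongr
      refine (hsq _ _ (le_min hl hM0.le) hm0.le).trans ?_
      gcongr
      exact min_le_right _ _
    · refine ae_of_all _ fun l => ?_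
      have h2 : Tendsto (fun ε : ℝ => l * √ε) (𝓝[>] 0) (𝓝 0) := by
        have : Continuous fun ε : ℝ => l * √ε := by fun_prop
        exact (this.tendsto' 0 0 (by simp)).mono_left nhdsWithin_le_nhds
      have h3 := (tendsto_specDensity h0 h1 hw).comp h2
      have h4 : Continuous fun a : ℝ => Real.exp (-(2 * b) * l ^ 2) * (√(min a M) - √m) ^ 2 := by
        fun_prop
      refine (h4.tendsto' m 0 ?_).comp h3
      rw [min_eq_left (by linarith [mixtureDensity_nonneg h0 (|w| / 2)])]
      simp
  rw [integral_zero] at hT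
  -- This is the integral of the bound on the outer region, computed in `hR'`.
  have hR : Tendsto (fun ε : ℝ => √ε / c * I + ε / c * (m * J)) (𝓝[>] 0) (𝓝 0) := by
    have : Continuous fun ε : ℝ => √ε / c * I + ε / c * (m * J) := by fun_prop
    exact (this.tendsto' 0 0 (by simp)).mono_left nhdsWithin_le_nhds
  have hTR := hT.add hR
  rw [add_zero] at hTR
  refine tendsto_of_tendsto_of_tendsto_of_le_of_le' tendsto_const_nhds hTR
    (Eventually.of_forall fun ε => integral_nonneg fun l => by positivity) ?_
  filter_upwards [self_mem_nhdsWithin] with ε hε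
  have hε0 : (0 : ℝ) < ε := hε
  have hs0 : 0 < √ε := Real.sqrt_pos.2 hε0
  have hi := integrable_scaled_specDensity w h0 h1 hε0
  have hscale : ∫ l, specDensity κ w (l * √ε) = (√ε)⁻¹ * I := by
    rw [Measure.integral_comp_mul_right, abs_of_pos (by positivity), smul_eq_mul]
  have hTi : Integrable fun l => Real.exp (-(2 * b) * l ^ 2) *
      (√(min (specDensity κ w (l * √ε)) M) - √m) ^ 2 := by
    refine (hgauss2.mul_const (M + m)).mono' ?_ ?_
    · refine (Continuous.aestronglyMeasurable (by fun_prop)).mul ?_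
      have : Continuous fun a : ℝ => (√(min a M) - √m) ^ 2 := by fun_prop
      exact this.comp_aestronglyMeasurable hi.aestronglyMeasurable
    · filter_upwards [scaled_specDensity_nonneg_ae w h0 h1 hε] with l hl
      rw [Real.norm_of_nonneg (by positivity)]
      gcongr
      refine (hsq _ _ (le_min hl hM0.le) hm0.le).trans ?_
      gcongr
      exact min_le_right _ _
  have hRi : Integrable fun l => ε / c * (specDensity κ w (l * √ε) + m * Real.exp (-b * l ^ 2)) :=
    (hi.add (hgauss.const_mul m)).const_mul _
  have hR' : ∫ l, ε / c * (specDensity κ w (l * √ε) + m * Real.exp (-b * l ^ 2)) =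
      √ε / c * I + ε / c * (m * J) := by
    rw [integral_const_mul, integral_add hi (hgauss.const_mul m), integral_const_mul, hscale,
      ← hJ, mul_add]
    congr 1
    have := Real.sq_sqrt hε0.le
    field_simp
    linear_combination (-I) * this
  rw [← hR', ← integral_add hTi hRi]
  refine integral_mono_of_nonneg (ae_of_all _ fun l => by positivity) (hTi.add hRi) ?_
  filter_upwards [scaled_specDensity_nonneg_ae w h0 h1 hε] with l hl
  have hnn : 0 ≤ specDensity κ w (l * √ε) + m * Real.exp (-b * l ^ 2) := by positivity
  by_cases hcase : |l * √ε| ≤ |w| / 2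
  · have h2 := (specDensity_of_abs_le h0 h1 hw hcase).2
    rw [min_eq_left (by linarith)]
    exact le_add_of_nonneg_right (by positivity)
  · push Not at hcase
    have h3 : c / ε ≤ b * l ^ 2 := by
      rw [div_le_iff₀ hε0, hc]
      have : (|w| / 2) ^ 2 ≤ |l * √ε| ^ 2 := by gcongr
      rw [sq_abs, mul_pow, Real.sq_sqrt hε0.le] at this
      nlinarith
    -- From `exp (c / ε) ≥ c / ε`.
    have h4 : Real.exp (-b * l ^ 2) ≤ ε / c := by
      calc Real.exp (-b * l ^ 2) ≤ Real.exp (-(c / ε)) := by gcongr; linarith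
        _ = (Real.exp (c / ε))⁻¹ := Real.exp_neg _
        _ ≤ (c / ε)⁻¹ := by
          gcongr
          linarith [Real.add_one_le_exp (c / ε)]
        _ = ε / c := inv_div _ _
    have h5 : Real.exp (-b * l ^ 2) ≤ 1 := by
      rw [Real.exp_le_one_iff]; nlinarith [sq_nonneg l]
    refine le_add_of_nonneg_of_le (by positivity) ?_
    calc _ ≤ Real.exp (-(2 * b) * l ^ 2) * (specDensity κ w (l * √ε) + m) := by
          gcongr; exact hsq _ _ hl hm0.le
      _ = Real.exp (-b * l ^ 2) * (Real.exp (-b * l ^ 2) * specDensity κ w (l * √ε) +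
            m * Real.exp (-b * l ^ 2)) := by
          rw [show -(2 * b) * l ^ 2 = -b * l ^ 2 + -b * l ^ 2 by ring, Real.exp_add]; ring
      _ ≤ _ := by
          gcongr
          exact mul_le_of_le_one_left hl h5

/-! ### The stochastic integral as an isometry -/

/-- The fibre over `0` may have infinite control measure, where nothing is known about `Z`, so it
has to be removed. -/
lemma simpleIntegral_eq_sum_filter {Ω : Type*} (Z : Set ℝ → Ω → ℂ) (s : SimpleFunc ℝ ℂ) (ω : Ω) :
    simpleIntegral Z s ω = ∑ y ∈ s.range with y ≠ 0, y * Z (s ⁻¹' {y}) ω := by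
  rw [simpleIntegral, Finset.sum_filter_of_ne]
  intro y _ h h0
  exact h (by rw [h0, zero_mul])

section StochInt

variable {Ω : Type*} [MeasurableSpace Ω] {P : Measure Ω} {F : Measure ℝ} {Z : Set ℝ → Ω → ℂ}

lemma inner_toLp {α : Type*} [MeasurableSpace α] {m : Measure α} {u v : α → ℂ}
    (hu : MemLp u 2 m) (hv : MemLp v 2 m) :
    inner ℂ (hv.toLp v) (hu.toLp u) = ∫ a, u a * (starRingEnd ℂ) (v a) ∂m := by
  rw [L2.inner_def]
  refine integral_congr_ae ?_
  filter_upwards [hu.coeFn_toLp, hv.coeFn_toLp] with a h1 h2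
  rw [h1, h2]
  rfl

/-- Two pairs with the same Gram matrix have the same distance. Applied to integrands and integrals,
this yields the Cauchy property, uniqueness and linearity without first building an isometry. -/
lemma norm_sub_eq_of_inner_eq {H K : Type*} [NormedAddCommGroup H] [InnerProductSpace ℂ H]
    [NormedAddCommGroup K] [InnerProductSpace ℂ K] {a b : H} {c d : K}
    (h1 : inner ℂ a a = inner ℂ c c) (h2 : inner ℂ a b = inner ℂ c d)
    (h3 : inner ℂ b b = inner ℂ d d) : ‖a - b‖ = ‖c - d‖ := by
  rw [← sq_eq_sq₀ (norm_nonneg _) (norm_nonneg _), norm_sub_sq (𝕜 := ℂ), norm_sub_sq (𝕜 := ℂ), h2,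
    ← inner_self_eq_norm_sq (𝕜 := ℂ) a, ← inner_self_eq_norm_sq (𝕜 := ℂ) b,
    ← inner_self_eq_norm_sq (𝕜 := ℂ) c, ← inner_self_eq_norm_sq (𝕜 := ℂ) d, h1, h3]

lemma tendsto_integral_mul_conj {α : Type*} [MeasurableSpace α] {m : Measure α}
    {u v : ℕ → α → ℂ} {u' v' : α → ℂ} (hu : ∀ n, MemLp (u n) 2 m) (hv : ∀ n, MemLp (v n) 2 m)
    (hu' : MemLp u' 2 m) (hv' : MemLp v' 2 m)
    (h1 : Tendsto (fun n => eLpNorm (fun a => u n a - u' a) 2 m) atTop (𝓝 0))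
    (h2 : Tendsto (fun n => eLpNorm (fun a => v n a - v' a) 2 m) atTop (𝓝 0)) :
    Tendsto (fun n => ∫ a, u n a * (starRingEnd ℂ) (v n a) ∂m) atTop
      (𝓝 (∫ a, u' a * (starRingEnd ℂ) (v' a) ∂m)) := by
  have h1' := (Lp.tendsto_Lp_iff_tendsto_eLpNorm'' u hu u' hu').2 h1
  have h2' := (Lp.tendsto_Lp_iff_tendsto_eLpNorm'' v hv v' hv').2 h2
  have h3 := h2'.inner (𝕜 := ℂ) h1'
  simpa only [inner_toLp] using h3

lemma IsGaussianRandomMeasure.memLp (hZ : IsGaussianRandomMeasure F Z P) {A : Set ℝ}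
    (hA : MeasurableSet A) (hA' : F A < ∞) : MemLp (Z A) 2 P :=
  (hZ.gaussian.hasGaussianLaw_eval ⟨A, hA, hA'⟩).memLp_two

lemma memLp_simpleIntegral (hZ : IsGaussianRandomMeasure F Z P) {s : SimpleFunc ℝ ℂ}
    (hs : MemLp s 2 F) : MemLp (simpleIntegral Z s) 2 P := by
  have : simpleIntegral Z s = fun ω => ∑ y ∈ s.range with y ≠ 0, y * Z (s ⁻¹' {y}) ω :=
    funext (simpleIntegral_eq_sum_filter Z s)
  rw [this]
  refine memLp_finsetSum _ fun y hy => ?_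
  exact (hZ.memLp (s.measurableSet_fiber y) (s.measure_preimage_lt_top_of_memLp two_ne_zero
    (by simp) hs y (Finset.mem_filter.1 hy).2)).const_mul y

lemma simpleFunc_eq_sum_filter (s : SimpleFunc ℝ ℂ) (l : ℝ) :
    s l = ∑ y ∈ s.range with y ≠ 0, (s ⁻¹' {y}).indicator (fun _ => y) l := by
  rw [Finset.sum_filter_of_ne]
  · rw [Finset.sum_eq_single (s l)]
    · rw [Set.indicator_of_mem (by simp)]
    · intro y _ hy
      refine Set.indicator_of_notMem (s := s ⁻¹' {y}) (fun h => hy ?_) _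
      exact (Set.mem_singleton_iff.1 h).symm
    · exact fun h => absurd (s.mem_range_self l) h
  · intro y _ h h0
    exact h (by rw [h0, Set.indicator_zero])

/-- The polarised isometry on simple functions: sesquilinear expansion over the fibres, with the
covariance of `Z` on each pair. -/
lemma integral_simpleIntegral_mul_conj (hZ : IsGaussianRandomMeasure F Z P)
    {s r : SimpleFunc ℝ ℂ} (hs : MemLp s 2 F) (hr : MemLp r 2 F) :
    ∫ ω, simpleIntegral Z s ω * (starRingEnd ℂ) (simpleIntegral Z r ω) ∂P =
      ∫ l, s l * (starRingEnd ℂ) (r l) ∂F := by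
  have fs : ∀ y ∈ s.range.filter (· ≠ 0), F (s ⁻¹' {y}) < ∞ := fun y hy =>
    s.measure_preimage_lt_top_of_memLp two_ne_zero (by simp) hs y (Finset.mem_filter.1 hy).2
  have fr : ∀ y ∈ r.range.filter (· ≠ 0), F (r ⁻¹' {y}) < ∞ := fun y hy =>
    r.measure_preimage_lt_top_of_memLp two_ne_zero (by simp) hr y (Finset.mem_filter.1 hy).2
  simp_rw [simpleIntegral_eq_sum_filter, map_sum, Finset.sum_mul_sum]
  have hint : ∀ y ∈ s.range.filter (· ≠ 0), ∀ z ∈ r.range.filter (· ≠ 0),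
      Integrable (fun ω => y * Z (s ⁻¹' {y}) ω * (starRingEnd ℂ) (z * Z (r ⁻¹' {z}) ω)) P :=
    fun y hy z hz => by
      have m1 := (hZ.memLp (s.measurableSet_fiber y) (fs y hy)).const_mul y
      have m2 := ((hZ.memLp (r.measurableSet_fiber z) (fr z hz)).const_mul z).star
      exact m1.integrable_mul m2
  rw [integral_finsetSum _ fun y hy => integrable_finsetSum _ (hint y hy)]
  have hR : ∀ l, s l * (starRingEnd ℂ) (r l) = ∑ y ∈ s.range with y ≠ 0,
      ∑ z ∈ r.range with z ≠ 0,
        (s ⁻¹' {y} ∩ r ⁻¹' {z}).indicator (fun _ => y * (starRingEnd ℂ) z) l := fun l => by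
    rw [simpleFunc_eq_sum_filter s l, simpleFunc_eq_sum_filter r l, map_sum, Finset.sum_mul_sum]
    refine Finset.sum_congr rfl fun y _ => Finset.sum_congr rfl fun z _ => ?_
    by_cases h1 : l ∈ s ⁻¹' {y} <;> by_cases h2 : l ∈ r ⁻¹' {z} <;>
      simp only [Set.indicator, Set.mem_inter_iff, h1, h2, and_true, and_false, if_true, if_false,
        map_zero, mul_zero, zero_mul]
  have hfin : ∀ y ∈ s.range.filter (· ≠ 0), ∀ z, F (s ⁻¹' {y} ∩ r ⁻¹' {z}) ≠ ∞ :=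
    fun y hy z => (measure_mono Set.inter_subset_left |>.trans_lt (fs y hy)).ne
  have hms : ∀ y z, MeasurableSet (s ⁻¹' {y} ∩ r ⁻¹' {z}) := fun y z =>
    (s.measurableSet_fiber y).inter (r.measurableSet_fiber z)
  have hint' : ∀ y ∈ s.range.filter (· ≠ 0), ∀ z ∈ r.range.filter (· ≠ 0),
      Integrable ((s ⁻¹' {y} ∩ r ⁻¹' {z}).indicator (fun _ => y * (starRingEnd ℂ) z)) F :=
    fun y hy z _ => (integrable_indicator_iff (hms y z)).2 (integrableOn_const (hfin y hy z))
  simp_rw [hR]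
  rw [integral_finsetSum _ fun y hy => integrable_finsetSum _ (hint' y hy)]
  refine Finset.sum_congr rfl fun y hy => ?_
  rw [integral_finsetSum _ (hint y hy), integral_finsetSum _ (hint' y hy)]
  refine Finset.sum_congr rfl fun z hz => ?_
  rw [integral_indicator_const _ (hms y z), Complex.real_smul]
  have h := hZ.covariance _ _ (s.measurableSet_fiber y) (fs y hy) (r.measurableSet_fiber z)
    (fr z hz)
  rw [Measure.real, ← h, ← integral_mul_const]
  congr with ω
  rw [map_mul]
  ring

lemma IsStochIntegral.integral_mul_conj (hZ : IsGaussianRandomMeasure F Z P) {g h : ℝ → ℂ}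
    {X Y : Ω → ℂ} (hX : IsStochIntegral F Z P g X) (hY : IsStochIntegral F Z P h Y) :
    ∫ ω, X ω * (starRingEnd ℂ) (Y ω) ∂P = ∫ l, g l * (starRingEnd ℂ) (h l) ∂F := by
  obtain ⟨hg, hXm, s, hs, hsg, hsX⟩ := hX
  obtain ⟨hh, hYm, r, hr, hrh, hrY⟩ := hY
  have h1 := tendsto_integral_mul_conj hs hr hg hh hsg hrh
  have h2 := tendsto_integral_mul_conj (fun n => memLp_simpleIntegral hZ (hs n))
    (fun n => memLp_simpleIntegral hZ (hr n)) hXm hYm hsX hrY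
  simp_rw [integral_simpleIntegral_mul_conj hZ (hs _) (hr _)] at h2
  exact tendsto_nhds_unique h2 h1

/-- Simple integrals have the mutual distances of their integrands, so they form a Cauchy sequence
in the complete space `L²(P)`. -/
lemma exists_isStochIntegral (hZ : IsGaussianRandomMeasure F Z P) {g : ℝ → ℂ}
    (hg : MemLp g 2 F) : ∃ X, IsStochIntegral F Z P g X := by
  have hex : ∀ n : ℕ, ∃ s : SimpleFunc ℝ ℂ, eLpNorm (g - ⇑s) 2 F < ((n : ℝ≥0∞) + 1)⁻¹ ∧
      MemLp s 2 F := fun n => hg.exists_simpleFunc_eLpNorm_sub_lt (by simp) (by simp)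
  choose s hs hsm using hex
  have hsg : Tendsto (fun n => eLpNorm (fun l => s n l - g l) 2 F) atTop (𝓝 0) := by
    have h0 : Tendsto (fun n : ℕ => ((n : ℝ≥0∞) + 1)⁻¹) atTop (𝓝 0) := by
      have := (tendsto_add_atTop_iff_nat 1).2 ENNReal.tendsto_inv_nat_nhds_zero
      simpa using this
    refine tendsto_of_tendsto_of_tendsto_of_le_of_le tendsto_const_nhds h0
      (fun _ => zero_le) fun n => ?_
    have := (hs n).le
    rwa [eLpNorm_sub_comm] at this
  have hconv := (Lp.tendsto_Lp_iff_tendsto_eLpNorm'' (fun n => s n) hsm g hg).2 hsg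
  have hSm := fun n => memLp_simpleIntegral hZ (hsm n)
  have hdist : ∀ m n, dist ((hSm m).toLp) ((hSm n).toLp) = dist ((hsm m).toLp) ((hsm n).toLp) :=
    fun m n => by
      rw [dist_eq_norm, dist_eq_norm]
      refine norm_sub_eq_of_inner_eq ?_ ?_ ?_ <;>
        rw [inner_toLp, inner_toLp, integral_simpleIntegral_mul_conj hZ (hsm _) (hsm _)]
  have hcau : CauchySeq fun n => (hSm n).toLp := by
    have := hconv.cauchySeq
    rw [Metric.cauchySeq_iff] at this ⊢
    simpa only [hdist] using this
  obtain ⟨X, hX⟩ := cauchySeq_tendsto_of_complete hcau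
  refine ⟨X, hg, Lp.memLp X, s, hsm, hsg, ?_⟩
  rw [← Lp.toLp_coeFn X (Lp.memLp X)] at hX
  exact (Lp.tendsto_Lp_iff_tendsto_eLpNorm'' _ hSm X (Lp.memLp X)).1 hX

lemma isStochIntegral_stochIntegral (hZ : IsGaussianRandomMeasure F Z P) {g : ℝ → ℂ}
    (hg : MemLp g 2 F) : IsStochIntegral F Z P g (stochIntegral F Z P g) := by
  have h := exists_isStochIntegral hZ hg
  rw [stochIntegral, dif_pos h]
  exact h.choose_spec

lemma memLp_stochIntegral (hZ : IsGaussianRandomMeasure F Z P) {g : ℝ → ℂ}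
    (hg : MemLp g 2 F) : MemLp (stochIntegral F Z P g) 2 P :=
  (isStochIntegral_stochIntegral hZ hg).2.1

lemma IsStochIntegral.ae_eq (hZ : IsGaussianRandomMeasure F Z P) {g h : ℝ → ℂ}
    {X Y : Ω → ℂ} (hX : IsStochIntegral F Z P g X) (hY : IsStochIntegral F Z P h Y)
    (hgh : g =ᵐ[F] h) : X =ᵐ[P] Y := by
  have key : ‖hX.2.1.toLp X - hY.2.1.toLp Y‖ = ‖hX.1.toLp g - hY.1.toLp h‖ := by
    refine norm_sub_eq_of_inner_eq ?_ ?_ ?_ <;> rw [inner_toLp, inner_toLp]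
    · exact hX.integral_mul_conj hZ hX
    · exact hY.integral_mul_conj hZ hX
    · exact hY.integral_mul_conj hZ hY
  rw [(MemLp.toLp_eq_toLp_iff hX.1 hY.1).2 hgh, sub_self, norm_zero, norm_eq_zero, sub_eq_zero] at key
  exact (MemLp.toLp_eq_toLp_iff _ _).1 key

lemma integral_stochIntegral_mul_conj (hZ : IsGaussianRandomMeasure F Z P) {g h : ℝ → ℂ}
    (hg : MemLp g 2 F) (hh : MemLp h 2 F) :
    ∫ ω, stochIntegral F Z P g ω * (starRingEnd ℂ) (stochIntegral F Z P h ω) ∂P =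
      ∫ l, g l * (starRingEnd ℂ) (h l) ∂F :=
  (isStochIntegral_stochIntegral hZ hg).integral_mul_conj hZ (isStochIntegral_stochIntegral hZ hh)

lemma inner_toLp_stochIntegral (hZ : IsGaussianRandomMeasure F Z P) {g h : ℝ → ℂ}
    (hg : MemLp g 2 F) (hh : MemLp h 2 F) :
    inner ℂ ((memLp_stochIntegral hZ hg).toLp) ((memLp_stochIntegral hZ hh).toLp) =
      inner ℂ (hg.toLp g) (hh.toLp h) := by
  rw [inner_toLp, inner_toLp, integral_stochIntegral_mul_conj hZ hh hg]

lemma eLpNorm_stochIntegral_sub (hZ : IsGaussianRandomMeasure F Z P) {g h : ℝ → ℂ}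
    (hg : MemLp g 2 F) (hh : MemLp h 2 F) :
    eLpNorm (fun ω => stochIntegral F Z P g ω - stochIntegral F Z P h ω) 2 P =
      eLpNorm (fun l => g l - h l) 2 F := by
  have h1 := norm_sub_eq_of_inner_eq (inner_toLp_stochIntegral hZ hg hg)
    (inner_toLp_stochIntegral hZ hg hh) (inner_toLp_stochIntegral hZ hh hh)
  rw [← dist_eq_norm, ← dist_eq_norm, dist_edist, dist_edist,
    ENNReal.toReal_eq_toReal_iff' (edist_ne_top _ _) (edist_ne_top _ _), Lp.edist_toLp_toLp,
    Lp.edist_toLp_toLp] at h1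
  exact h1

/-- Linearity follows from the isometry: the distance between the two sides equals that between the
integrand and itself, the latter being expanded as the sum in one of its two occurrences. -/
lemma stochIntegral_sum (hZ : IsGaussianRandomMeasure F Z P) {ι : Type*} [Fintype ι]
    {g : ι → ℝ → ℂ} (hg : ∀ i, MemLp (g i) 2 F) (c : ι → ℂ) :
    stochIntegral F Z P (fun l => ∑ i, c i * g i l) =ᵐ[P]
      fun ω => ∑ i, c i * stochIntegral F Z P (g i) ω := by
  have hG : MemLp (fun l => ∑ i, c i * g i l) 2 F :=
    memLp_finsetSum _ fun i _ => (hg i).const_mul (c i)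
  have hX := memLp_stochIntegral hZ hG
  have hXi := fun i => memLp_stochIntegral hZ (hg i)
  have hS : MemLp (fun ω => ∑ i, c i * stochIntegral F Z P (g i) ω) 2 P :=
    memLp_finsetSum _ fun i _ => (hXi i).const_mul (c i)
  have e1 : hG.toLp = ∑ i, c i • (hg i).toLp := by
    refine Lp.ext (hG.coeFn_toLp.trans ?_)
    have h2 : ∀ i, ∀ᵐ l ∂F, (c i • (hg i).toLp : Lp ℂ 2 F) l = c i * g i l := fun i => by
      filter_upwards [Lp.coeFn_smul (c i) ((hg i).toLp), (hg i).coeFn_toLp] with l h3 h4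
      rw [h3, Pi.smul_apply, h4, smul_eq_mul]
    filter_upwards [Lp.coeFn_finsetSum Finset.univ (fun i => c i • (hg i).toLp),
      ae_all_iff.2 h2] with l h3 h4
    rw [h3, Finset.sum_apply]
    exact (Finset.sum_congr rfl fun i _ => h4 i).symm
  have e2 : hS.toLp = ∑ i, c i • (hXi i).toLp := by
    refine Lp.ext (hS.coeFn_toLp.trans ?_)
    have h2 : ∀ i, ∀ᵐ ω ∂P, (c i • (hXi i).toLp : Lp ℂ 2 P) ω =
        c i * stochIntegral F Z P (g i) ω := fun i => by
      filter_upwards [Lp.coeFn_smul (c i) ((hXi i).toLp), (hXi i).coeFn_toLp] with l h3 h4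
      rw [h3, Pi.smul_apply, h4, smul_eq_mul]
    filter_upwards [Lp.coeFn_finsetSum Finset.univ (fun i => c i • (hXi i).toLp),
      ae_all_iff.2 h2] with l h3 h4
    rw [h3, Finset.sum_apply]
    exact (Finset.sum_congr rfl fun i _ => h4 i).symm
  have key : ‖hX.toLp - hS.toLp‖ = ‖hG.toLp - hG.toLp‖ := by
    refine norm_sub_eq_of_inner_eq (inner_toLp_stochIntegral hZ hG hG) ?_ ?_
    · nth_rewrite 2 [e1]
      rw [e2, inner_sum, inner_sum]
      refine Finset.sum_congr rfl fun i _ => ?_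
      rw [inner_smul_right, inner_smul_right, inner_toLp_stochIntegral hZ hG (hg i)]
    · rw [e1, e2, sum_inner, sum_inner]
      refine Finset.sum_congr rfl fun i _ => ?_
      rw [inner_sum, inner_sum]
      refine Finset.sum_congr rfl fun j _ => ?_
      rw [inner_smul_right, inner_smul_right, inner_smul_left, inner_smul_left,
        inner_toLp_stochIntegral hZ (hg i) (hg j)]
  rw [sub_self, norm_zero, norm_eq_zero, sub_eq_zero] at key
  exact (MemLp.toLp_eq_toLp_iff _ _).1 key

end StochInt

lemma dual_pi_eq_sum {ι : Type*} [Fintype ι] [DecidableEq ι] (L : (ι → ℝ) →L[ℝ] ℝ) (v : ι → ℝ) :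
    L v = ∑ i, L (Pi.single i 1) * v i := by
  conv_lhs => rw [← Finset.univ_sum_single v, map_sum]
  refine Finset.sum_congr rfl fun i _ => ?_
  have : (Pi.single i (v i) : ι → ℝ) = v i • Pi.single i 1 := by
    rw [← Pi.single_smul, smul_eq_mul, mul_one]
  rw [this, map_smul, smul_eq_mul, mul_comm]

section StochInt

variable {Ω : Type*} [MeasurableSpace Ω] {P : Measure Ω} {F : Measure ℝ} {Z : Set ℝ → Ω → ℂ}

/-! ### Integrals of Hermitian functions are real -/

/-- `F(-A) = E|Z(-A)|² = E|Z(A)|² = F(A)`. -/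
lemma IsGaussianRandomMeasure.isNegInvariant [IsFiniteMeasure F]
    (hZ : IsGaussianRandomMeasure F Z P) : F.IsNegInvariant := by
  refine ⟨Measure.ext fun A hA => ?_⟩
  have hA' : MeasurableSet (Neg.neg ⁻¹' A) := measurable_neg hA
  rw [Measure.neg, Measure.map_apply measurable_neg hA]
  have h1 := hZ.covariance A A hA (measure_lt_top F A) hA (measure_lt_top F A)
  have h2 := hZ.covariance _ _ hA' (measure_lt_top F _) hA' (measure_lt_top F _)
  have h3 : ∫ ω, Z (Neg.neg ⁻¹' A) ω * (starRingEnd ℂ) (Z (Neg.neg ⁻¹' A) ω) ∂P =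
      ∫ ω, Z A ω * (starRingEnd ℂ) (Z A ω) ∂P := by
    refine integral_congr_ae ?_
    filter_upwards [hZ.hermitian A hA (measure_lt_top F A)] with ω hω
    rw [hω, Complex.conj_conj, mul_comm]
  rw [h1, h2, Set.inter_self, Set.inter_self, Complex.ofReal_inj,
    ENNReal.toReal_eq_toReal_iff' (measure_ne_top F _) (measure_ne_top F _)] at h3
  exact h3

lemma simpleIntegral_conj_comp_neg (hZ : IsGaussianRandomMeasure F Z P) {s r : SimpleFunc ℝ ℂ}
    (hs : MemLp s 2 F) (hr : ∀ l, r l = (starRingEnd ℂ) (s (-l))) :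
    ∀ᵐ ω ∂P, simpleIntegral Z r ω = (starRingEnd ℂ) (simpleIntegral Z s ω) := by
  have hfib : ∀ y, r ⁻¹' {(starRingEnd ℂ) y} = Neg.neg ⁻¹' (s ⁻¹' {y}) := fun y => by
    ext l
    simp only [Set.mem_preimage, Set.mem_singleton_iff, hr]
    exact (starRingEnd ℂ).injective.eq_iff
  have hrange : r.range = s.range.image (starRingEnd ℂ) := by
    ext y
    simp only [SimpleFunc.mem_range, Finset.mem_image, Set.mem_range]
    constructor
    · rintro ⟨l, rfl⟩
      exact ⟨s (-l), ⟨-l, rfl⟩, (hr l).symm⟩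
    · rintro ⟨_, ⟨l, rfl⟩, rfl⟩
      exact ⟨-l, by rw [hr, neg_neg]⟩
  have h : ∀ᵐ ω ∂P, ∀ y ∈ s.range.filter (· ≠ 0),
      Z (Neg.neg ⁻¹' (s ⁻¹' {y})) ω = (starRingEnd ℂ) (Z (s ⁻¹' {y}) ω) := by
    rw [eventually_all_finset]
    intro y hy
    exact hZ.hermitian _ (s.measurableSet_fiber y) (s.measure_preimage_lt_top_of_memLp two_ne_zero
      (by simp) hs y (Finset.mem_filter.1 hy).2)
  filter_upwards [h] with ω hω
  rw [simpleIntegral, hrange, Finset.sum_image fun a _ b _ h => (starRingEnd ℂ).injective h,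
    simpleIntegral, map_sum]
  refine Finset.sum_congr rfl fun y hy => ?_
  by_cases hy0 : y = 0
  · simp [hy0]
  · rw [hfib, hω y (Finset.mem_filter.2 ⟨hy, hy0⟩), map_mul]

lemma IsStochIntegral.conj_comp_neg [F.IsNegInvariant] (hZ : IsGaussianRandomMeasure F Z P)
    {g : ℝ → ℂ} {X : Ω → ℂ} (hX : IsStochIntegral F Z P g X) :
    IsStochIntegral F Z P (fun l => (starRingEnd ℂ) (g (-l))) (fun ω => (starRingEnd ℂ) (X ω)) := by
  have hneg := Measure.measurePreserving_neg F
  have hmem : ∀ f : ℝ → ℂ, MemLp f 2 F → MemLp (fun l => (starRingEnd ℂ) (f (-l))) 2 F :=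
    fun f hf => (hf.comp_measurePreserving hneg).star
  obtain ⟨hg, hXm, s, hs, hsg, hsX⟩ := hX
  let r : ℕ → SimpleFunc ℝ ℂ := fun n =>
    ((s n).comp Neg.neg measurable_neg).map (starRingEnd ℂ)
  have hr : ∀ n l, r n l = (starRingEnd ℂ) (s n (-l)) := fun n l => rfl
  refine ⟨hmem g hg, hXm.star, r, fun n => hmem _ (hs n), ?_, ?_⟩
  · refine hsg.congr fun n => ?_
    refine (eLpNorm_comp_measurePreserving ((hs n).1.sub hg.1) hneg).symm.trans ?_
    refine eLpNorm_congr_norm_ae (ae_of_all _ fun l => ?_)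
    rw [hr, ← map_sub, RCLike.norm_conj]
    rfl
  · refine hsX.congr fun n => ?_
    refine eLpNorm_congr_norm_ae ?_
    filter_upwards [simpleIntegral_conj_comp_neg hZ (hs n) (hr n)] with ω hω
    rw [hω, ← map_sub, RCLike.norm_conj]

/-- For Hermitian `g` the conjugate of the integral is again a version of the integral of `g`, and
versions agree almost surely. -/
lemma stochIntegral_eq_ofReal_re [F.IsNegInvariant] (hZ : IsGaussianRandomMeasure F Z P)
    {g : ℝ → ℂ} (hg : MemLp g 2 F) (hh : ∀ l, (starRingEnd ℂ) (g (-l)) = g l) :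
    ∀ᵐ ω ∂P, stochIntegral F Z P g ω = ((stochIntegral F Z P g ω).re : ℂ) := by
  have h1 := isStochIntegral_stochIntegral hZ hg
  have h2 := h1.conj_comp_neg hZ
  filter_upwards [h2.ae_eq hZ h1 (ae_of_all _ hh)] with ω hω
  exact (Complex.conj_eq_iff_re.1 hω).symm

/-! ### Integrals are jointly Gaussian -/

/-- Means and variances converge, hence so do the Gaussian characteristic functions; their limit is
the Gaussian one, possibly degenerate. -/
lemma hasGaussianLaw_of_tendsto_eLpNorm [IsProbabilityMeasure P] {X : ℕ → Ω → ℝ} {Y : Ω → ℝ}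
    (hX : ∀ n, HasGaussianLaw (X n) P) (hY : MemLp Y 2 P)
    (h : Tendsto (fun n => eLpNorm (fun ω => X n ω - Y ω) 2 P) atTop (𝓝 0)) :
    HasGaussianLaw Y P ∧ Tendsto (fun n => ∫ ω, X n ω ∂P) atTop (𝓝 (∫ ω, Y ω ∂P)) := by
  have hXm := fun n => (hX n).memLp_two
  have hmean : Tendsto (fun n => ∫ ω, X n ω ∂P) atTop (𝓝 (∫ ω, Y ω ∂P)) := by
    refine tendsto_integral_of_L1' Y hY.1
      (Eventually.of_forall fun n => (hXm n).integrable one_le_two) ?_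
    refine tendsto_of_tendsto_of_tendsto_of_le_of_le tendsto_const_nhds h (fun _ => zero_le)
      fun n => ?_
    exact eLpNorm_le_eLpNorm_of_exponent_le one_le_two ((hXm n).1.sub hY.1)
  refine ⟨?_, hmean⟩
  have hsq : Tendsto (fun n => ∫ ω, X n ω ^ 2 ∂P) atTop (𝓝 (∫ ω, Y ω ^ 2 ∂P)) := by
    have hn : ∀ (u : Ω → ℝ) (hu : MemLp u 2 P), ∫ ω, u ω ^ 2 ∂P = ‖hu.toLp u‖ ^ 2 :=
      fun u hu => by
        rw [← real_inner_self_eq_norm_sq, L2.inner_def]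
        refine integral_congr_ae ?_
        filter_upwards [hu.coeFn_toLp] with ω hω
        rw [hω, real_inner_self_eq_norm_sq, Real.norm_eq_abs, sq_abs]
    have h1 := (Lp.tendsto_Lp_iff_tendsto_eLpNorm'' X hXm Y hY).2 h
    have h2 := h1.norm.pow 2
    simp_rw [← hn _ (hXm _), ← hn _ hY] at h2
    exact h2
  have hvar : Tendsto (fun n => Var[X n; P]) atTop (𝓝 Var[Y; P]) := by
    simp_rw [variance_eq_sub (hXm _), variance_eq_sub hY]
    exact hsq.sub (hmean.pow 2)
  have hdist := (tendstoInMeasure_of_tendsto_eLpNorm two_ne_zero (fun n => (hXm n).1) hY.1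
    h).tendstoInDistribution fun n => (hX n).aemeasurable
  have hchar := ProbabilityMeasure.tendsto_iff_tendsto_charFun.1 hdist.tendsto
  rw [hasGaussianLaw_iff_charFun_map_eq hY.aemeasurable]
  intro t
  have h1 := hchar t
  simp only [ProbabilityMeasure.coe_mk, (hX _).charFun_map_eq] at h1
  refine tendsto_nhds_unique h1 ?_
  simp_rw [RCLike.inner_apply, conj_trivial, mul_comm _ t, integral_const_mul, variance_const_mul]
  refine (Complex.continuous_exp.tendsto _).comp (Tendsto.sub ?_ ?_)
  · exact ((Complex.continuous_ofReal.tendsto _).comp (hmean.const_mul t)).mul_const _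
  · exact ((Complex.continuous_ofReal.tendsto _).comp (hvar.const_mul (t ^ 2))).div_const _

lemma hasGaussianLaw_simpleIntegral_re (hZ : IsGaussianRandomMeasure F Z P)
    {s : SimpleFunc ℝ ℂ} (hs : MemLp s 2 F) :
    HasGaussianLaw (fun ω => (simpleIntegral Z s ω).re) P := by
  let f : (s.range.filter (· ≠ 0) : Finset ℂ) → {A : Set ℝ // MeasurableSet A ∧ F A < ∞} := fun y =>
    ⟨s ⁻¹' {y.1}, s.measurableSet_fiber y.1, s.measure_preimage_lt_top_of_memLp two_ne_zero
      (by simp) hs y.1 (Finset.mem_filter.1 y.2).2⟩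
  -- Multiplication by a complex number is taken as a real-linear map of `ℂ`, since Gaussianity
  -- refers to real functionals.
  have h := ((hZ.gaussian.comp_right f).comp_left
    (fun y => ContinuousLinearMap.mul ℝ ℂ y.1)).hasGaussianLaw_fun_sum (I := Finset.univ)
  refine (h.map_fun Complex.reCLM).congr (ae_of_all _ fun ω => ?_)
  simp only [Complex.reCLM_apply]
  rw [simpleIntegral_eq_sum_filter]
  congr 1
  exact Finset.sum_coe_sort _ fun y => y * Z (s ⁻¹' {y}) ω

lemma integral_simpleIntegral (hZ : IsGaussianRandomMeasure F Z P)
    {s : SimpleFunc ℝ ℂ} (hs : MemLp s 2 F) : ∫ ω, simpleIntegral Z s ω ∂P = 0 := by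
  have := hZ.gaussian.isProbabilityMeasure
  have fs : ∀ y ∈ s.range.filter (· ≠ 0), F (s ⁻¹' {y}) < ∞ := fun y hy =>
    s.measure_preimage_lt_top_of_memLp two_ne_zero (by simp) hs y (Finset.mem_filter.1 hy).2
  simp_rw [simpleIntegral_eq_sum_filter]
  rw [integral_finsetSum _ fun y hy => ((hZ.memLp (s.measurableSet_fiber y) (fs y hy)).integrable
    one_le_two).const_mul y]
  refine Finset.sum_eq_zero fun y hy => ?_
  rw [integral_const_mul, hZ.mean_zero _ (s.measurableSet_fiber y) (fs y hy), mul_zero]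

lemma hasGaussianLaw_stochIntegral_re (hZ : IsGaussianRandomMeasure F Z P) {g : ℝ → ℂ}
    (hg : MemLp g 2 F) :
    HasGaussianLaw (fun ω => (stochIntegral F Z P g ω).re) P ∧
      ∫ ω, (stochIntegral F Z P g ω).re ∂P = 0 := by
  have := hZ.gaussian.isProbabilityMeasure
  obtain ⟨-, hX, s, hs, -, hsX⟩ := isStochIntegral_stochIntegral hZ hg
  have h := hasGaussianLaw_of_tendsto_eLpNorm
    (fun n => hasGaussianLaw_simpleIntegral_re hZ (hs n)) hX.re ?_
  · refine ⟨h.1, ?_⟩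
    refine tendsto_nhds_unique h.2 ?_
    have h0 : ∀ n, ∫ ω, (simpleIntegral Z (s n) ω).re ∂P = 0 := fun n => by
      have h1 := integral_re ((memLp_simpleIntegral hZ (hs n)).integrable one_le_two)
      rw [integral_simpleIntegral hZ (hs n)] at h1
      exact h1
    simp_rw [h0]
    exact tendsto_const_nhds
  · refine tendsto_of_tendsto_of_tendsto_of_le_of_le tendsto_const_nhds hsX (fun _ => zero_le)
      fun n => ?_
    refine eLpNorm_mono fun ω => ?_
    change ‖(simpleIntegral Z (s n) ω).re - (stochIntegral F Z P g ω).re‖ ≤ _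
    rw [← Complex.sub_re]
    exact Complex.abs_re_le_norm _

/-- By linearity, every real functional of the vector is almost surely the real part of a single
integral, whose law is already known. -/
lemma hasGaussianLaw_stochIntegral_re_pi (hZ : IsGaussianRandomMeasure F Z P) {ι : Type*}
    [Fintype ι] {g : ι → ℝ → ℂ} (hg : ∀ i, MemLp (g i) 2 F) :
    HasGaussianLaw (fun ω i => (stochIntegral F Z P (g i) ω).re) P := by
  classical
  have hm : AEMeasurable (fun ω i => (stochIntegral F Z P (g i) ω).re) P :=
    aemeasurable_pi_lambda _ fun i => (hasGaussianLaw_stochIntegral_re hZ (hg i)).1.aemeasurable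
  refine ⟨isGaussian_of_isGaussian_map fun L => ?_⟩
  rw [AEMeasurable.map_map_of_aemeasurable (by fun_prop) hm]
  refine HasGaussianLaw.isGaussian_map ?_
  have hL := dual_pi_eq_sum L
  have hG : MemLp (fun l => ∑ i, (L (Pi.single i 1) : ℂ) * g i l) 2 F :=
    memLp_finsetSum _ fun i _ => (hg i).const_mul _
  refine (hasGaussianLaw_stochIntegral_re hZ hG).1.congr ?_
  filter_upwards [stochIntegral_sum hZ hg fun i => (L (Pi.single i 1) : ℂ)] with ω hω
  rw [hω, Complex.re_sum, Function.comp_apply, hL]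
  refine Finset.sum_congr rfl fun i _ => ?_
  rw [Complex.re_ofReal_mul]

lemma integral_stochIntegral_re_mul_re [F.IsNegInvariant] (hZ : IsGaussianRandomMeasure F Z P)
    {g h : ℝ → ℂ} (hg : MemLp g 2 F) (hh : MemLp h 2 F)
    (hgs : ∀ l, (starRingEnd ℂ) (g (-l)) = g l) (hhs : ∀ l, (starRingEnd ℂ) (h (-l)) = h l) :
    ((∫ ω, (stochIntegral F Z P g ω).re * (stochIntegral F Z P h ω).re ∂P : ℝ) : ℂ) =
      ∫ l, g l * (starRingEnd ℂ) (h l) ∂F := by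
  rw [← integral_stochIntegral_mul_conj hZ hg hh, ← integral_complex_ofReal]
  refine integral_congr_ae ?_
  filter_upwards [stochIntegral_eq_ofReal_re hZ hg hgs, stochIntegral_eq_ofReal_re hZ hh hhs]
    with ω h1 h2
  rw [h2, h1, Complex.conj_ofReal, ← Complex.ofReal_mul, Complex.ofReal_re, Complex.ofReal_re]

lemma covariance_stochIntegral_re [F.IsNegInvariant] (hZ : IsGaussianRandomMeasure F Z P)
    {g h : ℝ → ℂ} (hg : MemLp g 2 F) (hh : MemLp h 2 F)
    (hgs : ∀ l, (starRingEnd ℂ) (g (-l)) = g l) (hhs : ∀ l, (starRingEnd ℂ) (h (-l)) = h l) :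
    ((cov[fun ω => (stochIntegral F Z P g ω).re, fun ω => (stochIntegral F Z P h ω).re; P] : ℝ)
      : ℂ) = ∫ l, g l * (starRingEnd ℂ) (h l) ∂F := by
  have := hZ.gaussian.isProbabilityMeasure
  rw [← integral_stochIntegral_re_mul_re hZ hg hh hgs hhs, covariance_eq_sub
    (hasGaussianLaw_stochIntegral_re hZ hg).1.memLp_two
    (hasGaussianLaw_stochIntegral_re hZ hh).1.memLp_two,
    (hasGaussianLaw_stochIntegral_re hZ hg).2, zero_mul, sub_zero]
  rfl

end StochInt

lemma identDistrib_of_hasGaussianLaw {Ω Ω' : Type*} [MeasurableSpace Ω] [MeasurableSpace Ω']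
    {P : Measure Ω} {P' : Measure Ω'} {ι : Type*} [Fintype ι]
    {X : Ω → ι → ℝ} {Y : Ω' → ι → ℝ} (hX : HasGaussianLaw X P) (hY : HasGaussianLaw Y P')
    (hm : ∀ i, ∫ ω, X ω i ∂P = ∫ ω, Y ω i ∂P')
    (hc : ∀ i j, cov[fun ω => X ω i, fun ω => X ω j; P] =
      cov[fun ω => Y ω i, fun ω => Y ω j; P']) : IdentDistrib X Y P P' := by
  classical
  have := hX.isProbabilityMeasure
  have := hY.isProbabilityMeasure
  have := hX.isGaussian_map
  have := hY.isGaussian_map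
  refine ⟨hX.aemeasurable, hY.aemeasurable, Measure.ext_of_charFunDual (funext fun L => ?_)⟩
  have hL := dual_pi_eq_sum L
  have hXi : ∀ i, MemLp (fun ω => X ω i) 2 P := fun i =>
    (hX.map_fun (ContinuousLinearMap.proj (R := ℝ) (φ := fun _ : ι => ℝ) i)).memLp_two
  have hYi : ∀ i, MemLp (fun ω => Y ω i) 2 P' := fun i =>
    (hY.map_fun (ContinuousLinearMap.proj (R := ℝ) (φ := fun _ : ι => ℝ) i)).memLp_two
  rw [hX.charFunDual_map_eq_fun, hY.charFunDual_map_eq_fun]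
  simp only [hL (X _), hL (Y _)]
  rw [variance_fun_sum fun i => (hXi i).const_mul _, variance_fun_sum fun i => (hYi i).const_mul _,
    integral_finsetSum _ fun i _ => ((hXi i).integrable one_le_two).const_mul _,
    integral_finsetSum _ fun i _ => ((hYi i).integrable one_le_two).const_mul _]
  simp_rw [integral_const_mul, covariance_const_mul_left, covariance_const_mul_right, hm, hc]

/-! ### Identification of the spectral measure -/

section Initial

variable {Ω : Type*} [MeasurableSpace Ω] {P : Measure Ω} {F : Measure ℝ} {Z : Set ℝ → Ω → ℂ}

lemma heatKernelFourier_zero_time (μ x : ℝ) :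
    (fun l : ℝ => Complex.exp (Complex.I * l * x)) = heatKernelFourier μ 0 x := by
  funext l
  simp [heatKernelFourier]

lemma covariance_congr_ae {X X' Y Y' : Ω → ℝ} (hX : X =ᵐ[P] X') (hY : Y =ᵐ[P] Y') :
    cov[X, Y; P] = cov[X', Y'; P] := by
  rw [covariance, covariance, integral_congr_ae hX, integral_congr_ae hY]
  refine integral_congr_ae ?_
  filter_upwards [hX, hY] with ω h1 h2
  rw [h1, h2]

/-- The covariance function of `η` is the characteristic function of `F`, and a finite measure is
determined by it. -/
lemma spectralMeasure_eq [IsFiniteMeasure F] (hZ : IsGaussianRandomMeasure F Z P) {κ w : ℝ}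
    (h0 : 0 < κ) (h1 : κ < 1) {η : ℝ → Ω → ℝ}
    (hη : ∀ x : ℝ, ∀ᵐ ω ∂P,
      (η x ω : ℂ) = stochIntegral F Z P (fun l => Complex.exp (Complex.I * l * x)) ω)
    (hcov : ∀ x : ℝ, cov[η 0, η x; P] = Real.cos (w * x) / (1 + x ^ 2) ^ (κ / 2)) :
    F = volume.withDensity fun l => ENNReal.ofReal (specDensity κ w l) := by
  have := hZ.isNegInvariant
  have := isFiniteMeasure_withDensity_specDensity w h0 h1
  have hre : ∀ x, η x =ᵐ[P] fun ω => (stochIntegral F Z P (heatKernelFourier 0 0 x) ω).re :=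
    fun x => by
      filter_upwards [hη x] with ω hω
      rw [← heatKernelFourier_zero_time, ← hω, Complex.ofReal_re]
  have hmem := fun x => memLp_heatKernelFourier_of_isFiniteMeasure (F := F) (μ := 0) (t := 0)
    le_rfl le_rfl x
  refine Measure.ext_of_charFun (funext fun x => ?_)
  rw [charFun_withDensity_specDensity w h0 h1]
  -- The second kernel is conjugated, so `-x` produces `exp (ilx)`; the given covariance is even.
  have hc := covariance_stochIntegral_re hZ (hmem 0) (hmem (-x))
    (conj_heatKernelFourier_neg 0 0 0) (conj_heatKernelFourier_neg 0 0 (-x))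
  rw [← covariance_congr_ae (hre 0) (hre (-x)), hcov, mul_neg, Real.cos_neg, neg_sq] at hc
  rw [hc, charFun_apply_real]
  refine integral_congr_ae (ae_of_all _ fun l => ?_)
  simp only [heatKernelFourier, ← Complex.exp_conj, ← Complex.exp_add]
  congr 1
  simp
  ring

/-! ### The solution as the heat semigroup applied to the initial condition -/

/-- The heat kernel acts on `exp (-ily)` as the multiplier `exp (-μtl²)`. The conjugate appears
because `η y` is the second factor in the covariances below. -/
lemma integral_gaussianKernel_mul_exp {μ t : ℝ} (hμ : 0 < μ) (ht : 0 < t) (x l : ℝ) :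
    ∫ y : ℝ, ((Real.exp (-(x - y) ^ 2 / (4 * μ * t)) : ℝ) : ℂ) *
        (starRingEnd ℂ) (heatKernelFourier μ 0 y l) =
      (√(4 * Real.pi * μ * t) : ℝ) * (starRingEnd ℂ) (heatKernelFourier μ t x l) := by
  have hb : 0 < (4 * μ * t)⁻¹ := by positivity
  have h := fourierIntegral_gaussian (b := ((4 * μ * t)⁻¹ : ℝ))
    (by rw [Complex.ofReal_re]; exact hb) (-l)
  have e : ∀ y : ℝ, ((Real.exp (-(x - y) ^ 2 / (4 * μ * t)) : ℝ) : ℂ) *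
      (starRingEnd ℂ) (heatKernelFourier μ 0 y l) = Complex.exp (-(Complex.I * l * x)) *
        (fun v : ℝ => Complex.exp (Complex.I * -l * v) *
          Complex.exp (-((4 * μ * t)⁻¹ : ℝ) * v ^ 2)) (y - x) := fun y => by
    simp only [heatKernelFourier, ← Complex.exp_conj, Complex.ofReal_exp, ← Complex.exp_add]
    congr 1
    simp
    ring
  simp_rw [e]
  rw [integral_const_mul, integral_sub_right_eq_self
    (fun v : ℝ => Complex.exp (Complex.I * -l * v) *
      Complex.exp (-((4 * μ * t)⁻¹ : ℝ) * v ^ 2)) x, h]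
  have e2 : ((Real.pi : ℂ) / ((4 * μ * t)⁻¹ : ℝ)) ^ (1 / 2 : ℂ) =
      ((√(4 * Real.pi * μ * t) : ℝ) : ℂ) := by
    rw [← Complex.ofReal_div, div_inv_eq_mul, show (1 / 2 : ℂ) = ((1 / 2 : ℝ) : ℂ) by push_cast; rfl,
      ← Complex.ofReal_cpow (by positivity), Real.sqrt_eq_rpow]
    ring_nf
  rw [e2, mul_left_comm, ← Complex.exp_add, heatKernelFourier, ← Complex.exp_conj]
  congr 2
  have h1 : (μ : ℂ) ≠ 0 := by exact_mod_cast hμ.ne'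
  have h2 : (t : ℂ) ≠ 0 := by exact_mod_cast ht.ne'
  simp
  field_simp
  ring

lemma integrable_gaussianKernel {μ t : ℝ} (hμ : 0 < μ) (ht : 0 < t) (x : ℝ) :
    Integrable fun y : ℝ => Real.exp (-(x - y) ^ 2 / (4 * μ * t)) := by
  refine ((integrable_exp_neg_mul_sq (b := (4 * μ * t)⁻¹) (by positivity)).comp_sub_left x).congr
    (ae_of_all _ fun y => ?_)
  simp only
  congr 1
  ring

/-- Weighted integrals of a measurable family of square integrable variables. -/
lemma integrable_prod_mul_weight [IsProbabilityMeasure P] {η : ℝ → Ω → ℝ}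
    (hη : Measurable (Function.uncurry η)) {C : ℝ} (hC : ∀ y, MemLp (η y) 2 P ∧
      ∫ ω, η y ω ^ 2 ∂P ≤ C) {k : ℝ → ℝ} (hk : Integrable k) (hk0 : ∀ y, 0 ≤ k y) {Y : Ω → ℝ}
    (hY : MemLp Y 2 P) :
    Integrable (fun p : ℝ × Ω => Y p.2 * (η p.1 p.2 * k p.1)) (volume.prod P) := by
  have hm : AEStronglyMeasurable (fun p : ℝ × Ω => Y p.2 * (η p.1 p.2 * k p.1))
      (volume.prod P) :=
    hY.1.comp_snd.mul (hη.aestronglyMeasurable.mul hk.1.comp_fst)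
  have hi : ∀ y, Integrable (fun ω => Y ω * η y ω) P := fun y => hY.integrable_mul (hC y).1
  refine (integrable_prod_iff hm).2 ⟨ae_of_all _ fun y => ?_, ?_⟩
  · refine ((hi y).mul_const (k y)).congr (ae_of_all _ fun ω => ?_)
    simp only
    ring
  · refine (hk.mul_const ((∫ ω, Y ω ^ 2 ∂P) + C)).mono' hm.norm.integral_prod_right'
      (ae_of_all _ fun y => ?_)
    rw [Real.norm_of_nonneg (integral_nonneg fun ω => norm_nonneg _)]
    have e : ∀ ω, ‖Y ω * (η y ω * k y)‖ = k y * ‖Y ω * η y ω‖ := fun ω => by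
      rw [← mul_assoc, norm_mul _ (k y), Real.norm_of_nonneg (hk0 y), mul_comm]
    simp only [e]
    rw [integral_const_mul]
    refine mul_le_mul_of_nonneg_left ?_ (hk0 y)
    have hsum : Integrable (fun ω => Y ω ^ 2 + η y ω ^ 2) P :=
      hY.integrable_sq.add (hC y).1.integrable_sq
    calc ∫ ω, ‖Y ω * η y ω‖ ∂P ≤ ∫ ω, (Y ω ^ 2 + η y ω ^ 2) ∂P := by
          refine integral_mono (hi y).norm hsum fun ω => ?_
          simp only
          rw [Real.norm_eq_abs, abs_mul]
          nlinarith [sq_nonneg (|Y ω| - |η y ω|), sq_abs (Y ω), sq_abs (η y ω),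
            sq_nonneg (Y ω), sq_nonneg (η y ω)]
      _ ≤ _ := by
          rw [integral_add hY.integrable_sq (hC y).1.integrable_sq]
          linarith [(hC y).2]

lemma integral_mul_weighted_integral [IsProbabilityMeasure P] {η : ℝ → Ω → ℝ}
    (hη : Measurable (Function.uncurry η)) {C : ℝ} (hC : ∀ y, MemLp (η y) 2 P ∧
      ∫ ω, η y ω ^ 2 ∂P ≤ C) {k : ℝ → ℝ} (hk : Integrable k) (hk0 : ∀ y, 0 ≤ k y) {Y : Ω → ℝ}
    (hY : MemLp Y 2 P) :
    ∫ ω, Y ω * (∫ y, η y ω * k y) ∂P = ∫ y, k y * ∫ ω, Y ω * η y ω ∂P := by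
  have h := integral_integral_swap (f := fun (y : ℝ) (ω : Ω) => Y ω * (η y ω * k y))
    (integrable_prod_mul_weight hη hC hk hk0 hY)
  simp_rw [integral_const_mul] at h
  rw [← h]
  congr with y
  rw [← integral_const_mul]
  congr with ω
  ring

/-- Cauchy–Schwarz with weight `k` bounds the squared path integral by `(∫ k) * ∫ η² k`, whose
expectation is finite. -/
lemma memLp_weighted_integral [IsProbabilityMeasure P] {η : ℝ → Ω → ℝ}
    (hη : Measurable (Function.uncurry η)) {C : ℝ} (hC : ∀ y, MemLp (η y) 2 P ∧
      ∫ ω, η y ω ^ 2 ∂P ≤ C) {k : ℝ → ℝ} (hk : Integrable k) (hk0 : ∀ y, 0 ≤ k y)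
    (hkpos : 0 < ∫ y, k y) :
    (∀ᵐ ω ∂P, Integrable fun y => η y ω * k y) ∧ MemLp (fun ω => ∫ y, η y ω * k y) 2 P := by
  have h1 := integrable_prod_mul_weight hη hC hk hk0 (memLp_const (1 : ℝ))
  simp only [one_mul] at h1
  have hae : ∀ᵐ ω ∂P, Integrable fun y => η y ω * k y := h1.prod_left_ae
  have hm2 : AEStronglyMeasurable (fun p : ℝ × Ω => η p.1 p.2 ^ 2 * k p.1) (volume.prod P) :=
    (hη.pow_const 2).aestronglyMeasurable.mul hk.1.comp_fst
  have h2 : Integrable (fun p : ℝ × Ω => η p.1 p.2 ^ 2 * k p.1) (volume.prod P) := by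
    refine (integrable_prod_iff hm2).2
      ⟨ae_of_all _ fun y => (hC y).1.integrable_sq.mul_const (k y), ?_⟩
    refine (hk.mul_const C).mono' hm2.norm.integral_prod_right' (ae_of_all _ fun y => ?_)
    rw [Real.norm_of_nonneg (integral_nonneg fun ω => norm_nonneg _)]
    have e : ∀ ω, ‖η y ω ^ 2 * k y‖ = k y * η y ω ^ 2 := fun ω => by
      rw [Real.norm_of_nonneg (mul_nonneg (sq_nonneg _) (hk0 y)), mul_comm]
    simp only [e]
    rw [integral_const_mul]
    exact mul_le_mul_of_nonneg_left (hC y).2 (hk0 y)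
  have hmI : AEStronglyMeasurable (fun ω => ∫ y, η y ω * k y) P :=
    h1.integral_prod_right.aestronglyMeasurable
  refine ⟨hae, (memLp_two_iff_integrable_sq hmI).2 ?_⟩
  refine (h2.integral_prod_right.const_mul (∫ y, k y)).mono' (hmI.pow 2) ?_
  filter_upwards [hae, h2.prod_left_ae] with ω i1 i2
  rw [Real.norm_of_nonneg (sq_nonneg _)]
  set A := ∫ y, k y
  set I := ∫ y, η y ω * k y with hI
  -- The weighted variance of the path is nonnegative; expanding it is the Cauchy–Schwarz
  -- inequality.
  have h3 : 0 ≤ ∫ y, (η y ω - I / A) ^ 2 * k y :=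
    integral_nonneg fun y => mul_nonneg (sq_nonneg _) (hk0 y)
  have e : ∀ y, (η y ω - I / A) ^ 2 * k y =
      η y ω ^ 2 * k y - 2 * (I / A) * (η y ω * k y) + (I / A) ^ 2 * k y := fun y => by ring
  simp_rw [e] at h3
  have i3 : Integrable fun y => η y ω ^ 2 * k y - 2 * (I / A) * (η y ω * k y) :=
    i2.sub (i1.const_mul _)
  rw [integral_add i3 (hk.const_mul _), integral_sub i2 (i1.const_mul _), integral_const_mul, integral_const_mul, ← hI] at h3
  have e2 : (I / A) ^ 2 * A = I * (I / A) := by field_simp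
  have e3 : A * (I * (I / A)) = I ^ 2 := by field_simp
  have h4 : I * (I / A) ≤ ∫ y, η y ω ^ 2 * k y := by linarith
  calc I ^ 2 = A * (I * (I / A)) := e3.symm
    _ ≤ _ := mul_le_mul_of_nonneg_left h4 hkpos.le

lemma integral_solution_mul_solution [IsFiniteMeasure F] (hZ : IsGaussianRandomMeasure F Z P)
    {μ s t : ℝ} (hμ : 0 ≤ μ) (hs : 0 ≤ s) (ht : 0 ≤ t) (z x : ℝ) :
    ((∫ ω, solution F Z P μ s z ω * solution F Z P μ t x ω ∂P : ℝ) : ℂ) =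
      ∫ l, heatKernelFourier μ s z l * (starRingEnd ℂ) (heatKernelFourier μ t x l) ∂F := by
  have := hZ.isNegInvariant
  exact integral_stochIntegral_re_mul_re hZ
    (memLp_heatKernelFourier_of_isFiniteMeasure hμ hs z)
    (memLp_heatKernelFourier_of_isFiniteMeasure hμ ht x)
    (conj_heatKernelFourier_neg μ s z) (conj_heatKernelFourier_neg μ t x)

lemma memLp_solution [IsFiniteMeasure F] (hZ : IsGaussianRandomMeasure F Z P)
    {μ t : ℝ} (hμ : 0 ≤ μ) (ht : 0 ≤ t) (x : ℝ) : MemLp (solution F Z P μ t x) 2 P :=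
  (hasGaussianLaw_stochIntegral_re hZ
    (memLp_heatKernelFourier_of_isFiniteMeasure hμ ht x)).1.memLp_two

lemma integral_gaussianKernel_mul_covariance [IsFiniteMeasure F]
    (hZ : IsGaussianRandomMeasure F Z P) {μ s t : ℝ} (hμ : 0 < μ) (hs : 0 ≤ s) (ht : 0 < t)
    (z x : ℝ) :
    ∫ y, Real.exp (-(x - y) ^ 2 / (4 * μ * t)) *
        ∫ ω, solution F Z P μ s z ω * solution F Z P μ 0 y ω ∂P =
      √(4 * Real.pi * μ * t) * ∫ ω, solution F Z P μ s z ω * solution F Z P μ t x ω ∂P := by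
  rw [← Complex.ofReal_inj, ← integral_complex_ofReal, Complex.ofReal_mul,
    integral_solution_mul_solution hZ hμ.le hs ht.le, ← integral_const_mul]
  simp_rw [Complex.ofReal_mul, integral_solution_mul_solution hZ hμ.le hs le_rfl,
    ← integral_const_mul]
  rw [integral_integral_swap]
  · refine integral_congr_ae (ae_of_all _ fun l => ?_)
    simp only
    rw [mul_left_comm, ← integral_gaussianKernel_mul_exp hμ ht, ← integral_const_mul]
    congr with y
    ring
  · refine ((integrable_gaussianKernel hμ ht x).mul_prod (integrable_const (1 : ℝ) (μ := F))).mono'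
      ?_ (ae_of_all _ fun p => ?_)
    · refine Continuous.aestronglyMeasurable ?_
      unfold Function.uncurry heatKernelFourier
      fun_prop
    · simp only [Function.uncurry, norm_mul, RCLike.norm_conj, Complex.norm_real, mul_one]
      rw [Real.norm_of_nonneg (Real.exp_nonneg _)]
      refine mul_le_of_le_one_right (Real.exp_nonneg _) (mul_le_one₀ ?_ (norm_nonneg _) ?_)
      · exact norm_heatKernelFourier_le_one hμ.le hs _ _
      · exact norm_heatKernelFourier_le_one hμ.le le_rfl _ _

/-- The difference `A * U - I` is orthogonal to every `solution F Z P μ s z`. Time `s = t` gives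
orthogonality to `U`, time `s = 0` to every `η y` and so, by Fubini, to `I`. It is therefore
orthogonal to itself. -/
lemma solution_eq_heatSemigroup [IsProbabilityMeasure P] [IsFiniteMeasure F]
    (hZ : IsGaussianRandomMeasure F Z P) {μ : ℝ} (hμ : 0 < μ) {η : ℝ → Ω → ℝ}
    (hη : ∀ x, η x =ᵐ[P] solution F Z P μ 0 x) (hm : Measurable (Function.uncurry η))
    {t : ℝ} (ht : 0 < t) (x : ℝ) :
    ∀ᵐ ω ∂P, Integrable (fun y => η y ω * Real.exp (-(x - y) ^ 2 / (4 * μ * t))) ∧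
      solution F Z P μ t x ω =
        1 / √(4 * Real.pi * μ * t) * ∫ y, η y ω * Real.exp (-(x - y) ^ 2 / (4 * μ * t)) := by
  set k : ℝ → ℝ := fun y => Real.exp (-(x - y) ^ 2 / (4 * μ * t)) with hk
  set A := √(4 * Real.pi * μ * t) with hA
  have hA0 : 0 < A := Real.sqrt_pos.2 (by positivity)
  have hki : Integrable k := integrable_gaussianKernel hμ ht x
  have hk0 : ∀ y, 0 ≤ k y := fun y => Real.exp_nonneg _
  have hkpos : 0 < ∫ y, k y := integral_exp_pos hki
  have hηm : ∀ y, MemLp (η y) 2 P := fun y =>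
    (memLp_solution hZ hμ.le le_rfl y).ae_eq (hη y).symm
  have hC : ∀ y, MemLp (η y) 2 P ∧ ∫ ω, η y ω ^ 2 ∂P ≤ F.real Set.univ := fun y => by
    refine ⟨hηm y, le_of_eq ?_⟩
    rw [← Complex.ofReal_inj]
    have h1 : ∫ ω, η y ω ^ 2 ∂P = ∫ ω, solution F Z P μ 0 y ω * solution F Z P μ 0 y ω ∂P := by
      refine integral_congr_ae ?_
      filter_upwards [hη y] with ω hω
      rw [hω, sq]
    rw [h1, integral_solution_mul_solution hZ hμ.le le_rfl le_rfl]
    have h2 : ∀ l, heatKernelFourier μ 0 y l * (starRingEnd ℂ) (heatKernelFourier μ 0 y l) = 1 :=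
      fun l => by
        rw [Complex.mul_conj, Complex.normSq_eq_norm_sq, norm_heatKernelFourier]
        simp
    simp_rw [h2]
    simp
  obtain ⟨hint, hI⟩ := memLp_weighted_integral hm hC hki hk0 hkpos
  set I : Ω → ℝ := fun ω => ∫ y, η y ω * k y with hIdef
  have hU := memLp_solution hZ hμ.le ht.le x
  set U := solution F Z P μ t x with hUdef
  have horth : ∀ s, 0 ≤ s → ∀ z, ∫ ω, solution F Z P μ s z ω * I ω ∂P =
      A * ∫ ω, solution F Z P μ s z ω * U ω ∂P := fun s hs z => by
    rw [hIdef, integral_mul_weighted_integral hm hC hki hk0 (memLp_solution hZ hμ.le hs z), hUdef,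
      hA, ← integral_gaussianKernel_mul_covariance hZ hμ hs ht]
    refine integral_congr_ae (ae_of_all _ fun y => ?_)
    simp only [hk]
    congr 1
    refine integral_congr_ae ?_
    filter_upwards [hη y] with ω hω
    rw [hω]
  have hmul : ∀ {f g : Ω → ℝ}, MemLp f 2 P → MemLp g 2 P → Integrable (fun ω => f ω * g ω) P :=
    fun hf hg => hf.integrable_mul hg
  have hD : MemLp (fun ω => A * U ω - I ω) 2 P := (hU.const_mul A).sub hI
  have hDs : ∀ s, 0 ≤ s → ∀ z, ∫ ω, (A * U ω - I ω) * solution F Z P μ s z ω ∂P = 0 :=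
    fun s hs z => by
      have hS := memLp_solution hZ hμ.le hs z
      have e : ∀ ω, (A * U ω - I ω) * solution F Z P μ s z ω =
          A * (solution F Z P μ s z ω * U ω) - solution F Z P μ s z ω * I ω := fun ω => by ring
      simp_rw [e]
      rw [integral_sub ((hmul hS hU).const_mul A) (hmul hS hI),
        integral_const_mul, horth s hs z, sub_self]
  have hDI : ∫ ω, (A * U ω - I ω) * I ω ∂P = 0 := by
    rw [hIdef, integral_mul_weighted_integral hm hC hki hk0 hD]
    refine integral_eq_zero_of_ae (ae_of_all _ fun y => ?_)
    have : ∫ ω, (A * U ω - I ω) * η y ω ∂P = 0 := by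
      rw [← hDs 0 le_rfl y]
      refine integral_congr_ae ?_
      filter_upwards [hη y] with ω hω
      rw [hω]
    simp only [this, mul_zero, Pi.zero_apply]
  have hDD : ∫ ω, (A * U ω - I ω) ^ 2 ∂P = 0 := by
    have e : ∀ ω, (A * U ω - I ω) ^ 2 =
        A * ((A * U ω - I ω) * U ω) - (A * U ω - I ω) * I ω := fun ω => by ring
    simp_rw [e]
    rw [integral_sub ((hmul hD hU).const_mul A) (hmul hD hI), hDI,
      integral_const_mul, hUdef, hDs t ht.le x, mul_zero, sub_zero]
  have hz := (integral_eq_zero_iff_of_nonneg (fun ω => sq_nonneg _) hD.integrable_sq).1 hDD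
  filter_upwards [hint, hz] with ω h1 h2
  refine ⟨h1, ?_⟩
  have h3 : A * U ω - I ω = 0 := pow_eq_zero_iff two_ne_zero |>.1 h2
  rw [one_div, eq_inv_mul_iff_mul_eq₀ hA0.ne']
  linarith

end Initial

/-! ### The limit field and the coupled field -/

section Fields

variable {Ω : Type*} [MeasurableSpace Ω] {P : Measure Ω} {W : Set ℝ → Ω → ℂ}

lemma solutionC_eq_solution {F : Measure ℝ} [IsFiniteMeasure F] {Z : Set ℝ → Ω → ℂ}
    (hZ : IsGaussianRandomMeasure F Z P) {μ t : ℝ} (hμ : 0 ≤ μ) (ht : 0 ≤ t) (x : ℝ) :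
    ∀ᵐ ω ∂P, solutionC F Z P μ t x ω = (solution F Z P μ t x ω : ℂ) := by
  have := hZ.isNegInvariant
  exact stochIntegral_eq_ofReal_re hZ (memLp_heatKernelFourier_of_isFiniteMeasure hμ ht x)
    (conj_heatKernelFourier_neg μ t x)

lemma limitField_eq (κ w μ t x : ℝ) : limitField W P κ w μ t x = fun ω =>
    √(cTwo κ / |w| ^ (1 - κ) * (1 - theta κ |w|)) *
      (stochIntegral volume W P (heatKernelFourier μ t x) ω).re := by
  funext ω
  rw [limitField, limitFieldC, Complex.re_ofReal_mul]

lemma limitFieldC_eq_limitField (hW : IsWhiteNoise W P) {μ t : ℝ} (hμ : 0 < μ) (ht : 0 < t)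
    (κ w x : ℝ) :
    ∀ᵐ ω ∂P, limitFieldC W P κ w μ t x ω = (limitField W P κ w μ t x ω : ℂ) := by
  filter_upwards [stochIntegral_eq_ofReal_re hW (memLp_heatKernelFourier hμ ht x)
    (conj_heatKernelFourier_neg μ t x)] with ω hω
  rw [limitField_eq, limitFieldC, hω, Complex.ofReal_mul]

lemma isGaussianProcess_limitField (hW : IsWhiteNoise W P) {μ : ℝ} (hμ : 0 < μ) (κ w : ℝ) :
    IsGaussianProcess (fun p : Set.Ioi (0 : ℝ) × ℝ => limitField W P κ w μ p.1 p.2) P := by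
  have h : IsGaussianProcess (fun (p : Set.Ioi (0 : ℝ) × ℝ) ω =>
      (stochIntegral volume W P (heatKernelFourier μ p.1 p.2) ω).re) P :=
    ⟨fun I => hasGaussianLaw_stochIntegral_re_pi hW
      (g := fun p : I => heatKernelFourier μ p.1.1 p.1.2)
      fun p => memLp_heatKernelFourier hμ p.1.1.2 p.1.2⟩
  simp_rw [limitField_eq]
  exact h.smul fun _ => _

lemma hasGaussianLaw_fieldAt_limitField (hW : IsWhiteNoise W P) {μ : ℝ} (hμ : 0 < μ) (κ w : ℝ)
    {n : ℕ} {t : Fin n → ℝ} (ht : ∀ i, 0 < t i) (x : Fin n → ℝ) :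
    HasGaussianLaw (fieldAt (limitField W P κ w μ) t x) P := by
  have h := (hasGaussianLaw_stochIntegral_re_pi hW
    fun i => memLp_heatKernelFourier hμ (ht i) (x i)).fun_smul
      (√(cTwo κ / |w| ^ (1 - κ) * (1 - theta κ |w|)))
  refine h.congr (ae_of_all _ fun ω => funext fun i => ?_)
  rw [fieldAt, limitField_eq]
  rfl

lemma integral_limitField (hW : IsWhiteNoise W P) {μ t : ℝ} (hμ : 0 < μ) (ht : 0 < t)
    (κ w x : ℝ) : ∫ ω, limitField W P κ w μ t x ω ∂P = 0 := by
  rw [limitField_eq, integral_const_mul,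
    (hasGaussianLaw_stochIntegral_re hW (memLp_heatKernelFourier hμ ht x)).2, mul_zero]

lemma integral_heatKernelFourier_mul_conj {μ t t' : ℝ} (hμ : 0 < μ) (ht : 0 < t) (ht' : 0 < t')
    (x x' : ℝ) :
    ∫ l, heatKernelFourier μ t x l * (starRingEnd ℂ) (heatKernelFourier μ t' x' l) =
      ((√Real.pi / √μ * (Real.exp (-(x - x') ^ 2 / (4 * μ * (t + t'))) / √(t + t')) : ℝ) : ℂ) := by
  have hb : 0 < μ * (t + t') := by positivity
  have h := fourierIntegral_gaussian (b := (μ * (t + t') : ℝ))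
    (by rw [Complex.ofReal_re]; exact hb) ((x - x' : ℝ) : ℂ)
  have e : ∀ l : ℝ, heatKernelFourier μ t x l * (starRingEnd ℂ) (heatKernelFourier μ t' x' l) =
      Complex.exp (Complex.I * (x - x' : ℝ) * l) * Complex.exp (-(μ * (t + t') : ℝ) * l ^ 2) :=
    fun l => by
      simp only [heatKernelFourier, ← Complex.exp_conj, ← Complex.exp_add]
      congr 1
      simp
      ring
  simp_rw [e]
  rw [h, ← Complex.ofReal_div, show (1 / 2 : ℂ) = ((1 / 2 : ℝ) : ℂ) by push_cast; rfl,
    ← Complex.ofReal_cpow (by positivity), ← Real.sqrt_eq_rpow, Real.sqrt_div Real.pi_pos.le,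
    Real.sqrt_mul hμ.le]
  have e2 : Complex.exp (-((x - x' : ℝ) : ℂ) ^ 2 / (4 * (μ * (t + t') : ℝ))) =
      ((Real.exp (-(x - x') ^ 2 / (4 * μ * (t + t'))) : ℝ) : ℂ) := by
    rw [Complex.ofReal_exp]
    congr 1
    push_cast
    ring
  rw [e2, ← Complex.ofReal_mul, Complex.ofReal_inj]
  ring

lemma covariance_limitField (hW : IsWhiteNoise W P) {μ κ w : ℝ} (hμ : 0 < μ) (h0 : 0 < κ)
    (h1 : κ < 1) (hw : w ≠ 0) {t t' : ℝ} (ht : 0 < t) (ht' : 0 < t') (x x' : ℝ) :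
    cov[limitField W P κ w μ t x, limitField W P κ w μ t' x'; P] =
      cTwo κ * √Real.pi * (1 - theta κ |w|) / (√μ * |w| ^ (1 - κ)) *
        (Real.exp (-(x - x') ^ 2 / (4 * μ * (t + t'))) / √(t + t')) := by
  have hc := covariance_stochIntegral_re hW (memLp_heatKernelFourier hμ ht x)
    (memLp_heatKernelFourier hμ ht' x') (conj_heatKernelFourier_neg μ t x)
    (conj_heatKernelFourier_neg μ t' x')
  rw [integral_heatKernelFourier_mul_conj hμ ht ht', Complex.ofReal_inj] at hc
  -- The squared amplitude equals `mixtureDensity κ w`, so its square root is not truncated to `0`.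
  have hnn : 0 ≤ cTwo κ / |w| ^ (1 - κ) * (1 - theta κ |w|) := by
    rw [limitVariance_eq h0 h1 hw]; exact mixtureDensity_nonneg h0 w
  rw [limitField_eq, limitField_eq, covariance_const_mul_left, covariance_const_mul_right, hc,
    ← mul_assoc, Real.mul_self_sqrt hnn]
  ring

/-! ### The coupled field and the scaling identity -/

lemma specDensity_neg (κ w l : ℝ) : specDensity κ w (-l) = specDensity κ w l := by
  rw [specDensity, specDensity, ← abs_neg (-l + w), ← abs_neg (-l - w), neg_add, neg_neg, neg_sub',
    neg_neg, sub_neg_eq_add, ← sub_eq_add_neg, add_comm ((1 - theta κ |l - w|) / _)]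

lemma conj_heatKernelFourier_mul_sqrt_neg (κ w μ ε t x l : ℝ) :
    (starRingEnd ℂ) (heatKernelFourier μ t x (-l) * (√(specDensity κ w (-l * √ε)) : ℝ)) =
      heatKernelFourier μ t x l * (√(specDensity κ w (l * √ε)) : ℝ) := by
  rw [map_mul, conj_heatKernelFourier_neg, Complex.conj_ofReal, neg_mul, specDensity_neg]

lemma coupledFieldC_eq_coupledField (hW : IsWhiteNoise W P) {μ κ : ℝ} (w : ℝ) (hμ : 0 < μ)
    (h0 : 0 < κ) (h1 : κ < 1) {ε t : ℝ} (hε : 0 < ε) (ht : 0 < t) (x : ℝ) :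
    ∀ᵐ ω ∂P, coupledFieldC W P κ w μ ε t x ω = (coupledField W P κ w μ ε t x ω : ℂ) :=
  stochIntegral_eq_ofReal_re hW
    (memLp_heatKernelFourier_mul_sqrt_specDensity w h0 h1 hμ ht x hε)
    (conj_heatKernelFourier_mul_sqrt_neg κ w μ ε t x)

lemma hasGaussianLaw_fieldAt_coupledField (hW : IsWhiteNoise W P) {μ κ : ℝ} (w : ℝ) (hμ : 0 < μ)
    (h0 : 0 < κ) (h1 : κ < 1) {ε : ℝ} (hε : 0 < ε) {n : ℕ} {t : Fin n → ℝ} (ht : ∀ i, 0 < t i)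
    (x : Fin n → ℝ) : HasGaussianLaw (fieldAt (coupledField W P κ w μ ε) t x) P :=
  hasGaussianLaw_stochIntegral_re_pi hW fun i =>
    memLp_heatKernelFourier_mul_sqrt_specDensity w h0 h1 hμ (ht i) (x i) hε

lemma heatKernelFourier_scale {ε : ℝ} (hε : 0 < ε) (μ t x l : ℝ) :
    heatKernelFourier μ (t / ε) (x / √ε) (l * √ε) = heatKernelFourier μ t x l := by
  rw [heatKernelFourier, heatKernelFourier]
  congr 1
  have h2 : ((√ε : ℝ) : ℂ) ≠ 0 := by exact_mod_cast (Real.sqrt_pos.2 hε).ne'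
  have h3 : (ε : ℂ) = ((√ε : ℝ) : ℂ) ^ 2 := by exact_mod_cast (Real.sq_sqrt hε.le).symm
  push_cast
  rw [h3]
  field_simp

/-- Parabolic scaling leaves the kernel unchanged under `l ↦ l√ε`, and the Jacobian `1/√ε` is the
square of the prefactor `ε^(-1/4)` in `rescaled`. -/
lemma integral_scaled_heatKernelFourier {κ : ℝ} (w : ℝ) (h0 : 0 < κ) (h1 : κ < 1) {ε : ℝ}
    (hε : 0 < ε) (μ t x t' x' : ℝ) :
    ((√ε)⁻¹ : ℝ) * ∫ l, heatKernelFourier μ (t / ε) (x / √ε) l *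
        (starRingEnd ℂ) (heatKernelFourier μ (t' / ε) (x' / √ε) l)
        ∂(volume.withDensity fun l => ENNReal.ofReal (specDensity κ w l)) =
      ∫ l, heatKernelFourier μ t x l * (√(specDensity κ w (l * √ε)) : ℝ) *
        (starRingEnd ℂ) (heatKernelFourier μ t' x' l * (√(specDensity κ w (l * √ε)) : ℝ)) := by
  have hs := Real.sqrt_pos.2 hε
  have h := Measure.integral_comp_mul_right (fun l : ℝ => (specDensity κ w l : ℂ) *
    (heatKernelFourier μ (t / ε) (x / √ε) l *
      (starRingEnd ℂ) (heatKernelFourier μ (t' / ε) (x' / √ε) l))) (√ε)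
  rw [abs_of_pos (inv_pos.2 hs), Complex.real_smul] at h
  rw [integral_withDensity_specDensity w h0 h1, ← h]
  refine integral_congr_ae ?_
  filter_upwards [scaled_specDensity_nonneg_ae w h0 h1 hε] with l hl
  rw [heatKernelFourier_scale hε, heatKernelFourier_scale hε, map_mul, Complex.conj_ofReal]
  have h3 : (specDensity κ w (l * √ε) : ℂ) = (√(specDensity κ w (l * √ε)) : ℝ) *
      (√(specDensity κ w (l * √ε)) : ℝ) := by
    rw [← Complex.ofReal_mul, Real.mul_self_sqrt hl]
  linear_combination (heatKernelFourier μ t x l *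
    (starRingEnd ℂ) (heatKernelFourier μ t' x' l)) * h3

lemma sameFdd_rescaled_coupledField {Ω' : Type*} [MeasurableSpace Ω'] {P' : Measure Ω'}
    {F : Measure ℝ} [IsFiniteMeasure F] {Z : Set ℝ → Ω' → ℂ}
    (hZ : IsGaussianRandomMeasure F Z P') (hW : IsWhiteNoise W P) {μ κ w : ℝ} (hμ : 0 < μ)
    (h0 : 0 < κ) (h1 : κ < 1)
    (hF : F = volume.withDensity fun l => ENNReal.ofReal (specDensity κ w l))
    {ε : ℝ} (hε : 0 < ε) :
    SameFdd (rescaled F Z P' μ ε) P' (coupledField W P κ w μ ε) P := by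
  intro n t x ht
  have := hZ.isNegInvariant
  have hmem : ∀ i, MemLp (heatKernelFourier μ (t i / ε) (x i / √ε)) 2 F := fun i =>
    memLp_heatKernelFourier_of_isFiniteMeasure hμ.le (div_nonneg (ht i).le hε.le) _
  have hmem' := fun i => memLp_heatKernelFourier_mul_sqrt_specDensity w h0 h1 hμ (ht i) (x i) hε
  have hX : HasGaussianLaw (fieldAt (rescaled F Z P' μ ε) t x) P' :=
    (hasGaussianLaw_stochIntegral_re_pi hZ hmem).fun_smul (ε ^ (-(1 / 4) : ℝ))
  refine identDistrib_of_hasGaussianLaw hX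
    (hasGaussianLaw_fieldAt_coupledField hW w hμ h0 h1 hε ht x) (fun i => ?_) (fun i j => ?_)
  · simp only [fieldAt, rescaled, coupledField, solution, solutionC, coupledFieldC]
    rw [integral_const_mul, (hasGaussianLaw_stochIntegral_re hZ (hmem i)).2,
      (hasGaussianLaw_stochIntegral_re hW (hmem' i)).2, mul_zero]
  · simp only [fieldAt, rescaled, coupledField, solution, solutionC, coupledFieldC]
    rw [covariance_const_mul_left, covariance_const_mul_right, ← Complex.ofReal_inj,
      covariance_stochIntegral_re hW (hmem' i) (hmem' j)
        (conj_heatKernelFourier_mul_sqrt_neg κ w μ ε (t i) (x i))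
        (conj_heatKernelFourier_mul_sqrt_neg κ w μ ε (t j) (x j)),
      ← integral_scaled_heatKernelFourier w h0 h1 hε, ← hF, ← mul_assoc, Complex.ofReal_mul,
      covariance_stochIntegral_re hZ (hmem i) (hmem j) (conj_heatKernelFourier_neg μ _ _)
        (conj_heatKernelFourier_neg μ _ _), ← Real.rpow_add hε, Real.sqrt_eq_rpow,
      ← Real.rpow_neg hε.le]
    norm_num

/-! ### Mean-square convergence and finite-dimensional distributions -/

lemma stochIntegral_const_mul {F : Measure ℝ} {Z : Set ℝ → Ω → ℂ}
    (hZ : IsGaussianRandomMeasure F Z P) {g : ℝ → ℂ} (hg : MemLp g 2 F) (c : ℂ) :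
    stochIntegral F Z P (fun l => c * g l) =ᵐ[P] fun ω => c * stochIntegral F Z P g ω := by
  simpa using stochIntegral_sum hZ (ι := Unit) (fun _ => hg) (fun _ => c)

lemma tendsto_eLpNorm_kernel_sub {κ w : ℝ} (h0 : 0 < κ) (h1 : κ < 1) (hw : w ≠ 0) {μ t : ℝ}
    (hμ : 0 < μ) (ht : 0 < t) (x : ℝ) :
    Tendsto (fun ε : ℝ => eLpNorm (fun l => heatKernelFourier μ t x l *
      (√(specDensity κ w (l * √ε)) : ℝ) - (√(mixtureDensity κ w) : ℝ) * heatKernelFourier μ t x l)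
      2 volume) (𝓝[>] 0) (𝓝 0) := by
  -- The squared modulus of the kernel is `exp (-2μtl²)`, so `b = μt`.
  have h := tendsto_integral_scaled_specDensity h0 h1 hw (mul_pos hμ ht)
  have h2 : Continuous fun a : ℝ => ENNReal.ofReal √a :=
    ENNReal.continuous_ofReal.comp Real.continuous_sqrt
  have h3 := (h2.tendsto' 0 0 (by simp)).comp h
  refine h3.congr' ?_
  filter_upwards [self_mem_nhdsWithin] with ε hε
  have hm := (memLp_heatKernelFourier_mul_sqrt_specDensity w h0 h1 hμ ht x hε).sub
    ((memLp_heatKernelFourier hμ ht x).const_mul ((√(mixtureDensity κ w) : ℝ) : ℂ))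
  refine Eq.trans ?_ (hm.eLpNorm_eq_integral_rpow_norm two_ne_zero (by simp)).symm
  simp only [ENNReal.toReal_ofNat, Real.rpow_ofNat, Function.comp_apply]
  rw [Real.sqrt_eq_rpow, one_div]
  congr 3 with l
  simp only [Pi.sub_apply]
  rw [mul_comm _ (heatKernelFourier μ t x l), ← mul_sub, norm_mul, mul_pow, ← Complex.ofReal_sub,
    Complex.norm_real, Real.norm_eq_abs, sq_abs, norm_heatKernelFourier, ← Real.exp_nat_mul]
  congr 2
  push_cast
  ring

lemma tendsto_eLpNorm_coupledField_sub (hW : IsWhiteNoise W P) {κ w : ℝ} (h0 : 0 < κ)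
    (h1 : κ < 1) (hw : w ≠ 0) {μ t : ℝ} (hμ : 0 < μ) (ht : 0 < t) (x : ℝ) :
    Tendsto (fun ε : ℝ => eLpNorm
      (fun ω => coupledField W P κ w μ ε t x ω - limitField W P κ w μ t x ω) 2 P)
      (𝓝[>] 0) (𝓝 0) := by
  refine tendsto_of_tendsto_of_tendsto_of_le_of_le' tendsto_const_nhds
    (tendsto_eLpNorm_kernel_sub h0 h1 hw hμ ht x) (Eventually.of_forall fun _ => zero_le) ?_
  filter_upwards [self_mem_nhdsWithin] with ε hε
  have hg := memLp_heatKernelFourier hμ ht x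
  rw [← eLpNorm_stochIntegral_sub hW
    (memLp_heatKernelFourier_mul_sqrt_specDensity w h0 h1 hμ ht x hε)
    (hg.const_mul ((√(mixtureDensity κ w) : ℝ) : ℂ))]
  refine eLpNorm_mono_ae ?_
  filter_upwards [stochIntegral_const_mul hW hg ((√(mixtureDensity κ w) : ℝ) : ℂ)] with ω hω
  rw [hω, coupledField, limitField, limitFieldC, limitVariance_eq h0 h1 hw, ← Complex.sub_re,
    Real.norm_eq_abs]
  exact Complex.abs_re_le_norm _

/-- The rescaled field is replaced by the coupled field of equal law, which lives on the space of
`W`. There mean-square convergence gives convergence in measure and hence in distribution. -/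
lemma fddTendsto_rescaled {Ω' : Type*} [MeasurableSpace Ω'] {P' : Measure Ω'}
    [IsProbabilityMeasure P] [IsProbabilityMeasure P']
    {F : Measure ℝ} [IsFiniteMeasure F] {Z : Set ℝ → Ω' → ℂ}
    (hZ : IsGaussianRandomMeasure F Z P') (hW : IsWhiteNoise W P) {μ κ w : ℝ} (hμ : 0 < μ)
    (h0 : 0 < κ) (h1 : κ < 1) (hw : w ≠ 0)
    (hF : F = volume.withDensity fun l => ENNReal.ofReal (specDensity κ w l)) :
    FddTendsto (rescaled F Z P' μ) P' (limitField W P κ w μ) P := by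
  intro n t x ht
  have hG := fun ε : Set.Ioi (0 : ℝ) =>
    hasGaussianLaw_fieldAt_coupledField hW w hμ h0 h1 ε.2 ht x
  have hL := hasGaussianLaw_fieldAt_limitField hW hμ κ w ht x
  have hlim : Tendsto ((↑) : Set.Ioi (0 : ℝ) → ℝ) (comap Subtype.val (𝓝 0)) (𝓝[>] 0) :=
    tendsto_nhdsWithin_iff.2 ⟨tendsto_comap, Eventually.of_forall fun ε => ε.2⟩
  have hnorm : Tendsto (fun ε : Set.Ioi (0 : ℝ) => eLpNorm
      (fieldAt (coupledField W P κ w μ ε) t x - fieldAt (limitField W P κ w μ) t x) 2 P)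
      (comap Subtype.val (𝓝 0)) (𝓝 0) := by
    have hsum : Tendsto (fun ε : Set.Ioi (0 : ℝ) => ∑ i, eLpNorm
        (fun ω => ‖coupledField W P κ w μ ε (t i) (x i) ω - limitField W P κ w μ (t i) (x i) ω‖)
        2 P) (comap Subtype.val (𝓝 0)) (𝓝 (∑ _i : Fin n, 0)) := by
      refine tendsto_finsetSum _ fun i _ => ?_
      simp_rw [eLpNorm_norm]
      exact (tendsto_eLpNorm_coupledField_sub hW h0 h1 hw hμ (ht i) (x i)).comp hlim
    rw [Finset.sum_const_zero] at hsum
    refine tendsto_of_tendsto_of_tendsto_of_le_of_le tendsto_const_nhds hsum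
      (fun _ => zero_le) fun ε => ?_
    refine le_trans ?_ (eLpNorm_sum_le (fun i _ => ?_) one_le_two)
    -- The sup norm of the vector is at most the sum of the moduli of its coordinates.
    · refine eLpNorm_mono fun ω => ?_
      rw [Finset.sum_apply, Real.norm_of_nonneg (Finset.sum_nonneg fun i _ => norm_nonneg _)]
      refine (pi_norm_le_iff_of_nonneg (Finset.sum_nonneg fun i _ => norm_nonneg _)).2 fun i => ?_
      exact Finset.single_le_sum (f := fun i => ‖coupledField W P κ w μ ε (t i) (x i) ω -
        limitField W P κ w μ (t i) (x i) ω‖) (fun i _ => norm_nonneg _) (Finset.mem_univ i)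
    · have m1 := (hG ε).aemeasurable.eval i
      have m2 := hL.aemeasurable.eval i
      exact (m1.sub m2).norm.aestronglyMeasurable
  have hd := (tendstoInMeasure_of_tendsto_eLpNorm two_ne_zero
    (fun ε => (hG ε).aemeasurable.aestronglyMeasurable)
    hL.aemeasurable.aestronglyMeasurable hnorm).tendstoInDistribution_of_aemeasurable
    (fun ε => (hG ε).aemeasurable) hL.aemeasurable
  have hid := fun ε : Set.Ioi (0 : ℝ) =>
    sameFdd_rescaled_coupledField hZ hW hμ h0 h1 hF ε.2 n t x ht
  refine ⟨fun ε => (hid ε).aemeasurable_fst, hL.aemeasurable, ?_⟩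
  refine hd.tendsto.congr fun ε => ?_
  exact Subtype.ext (hid ε).map_eq.symm

/-! ### Stationarity in space, non-stationarity in time -/

lemma stationaryInSpace_limitField (hW : IsWhiteNoise W P) {μ κ w : ℝ} (hμ : 0 < μ) (h0 : 0 < κ)
    (h1 : κ < 1) (hw : w ≠ 0) : StationaryInSpace (limitField W P κ w μ) P := by
  intro h n t x ht
  refine identDistrib_of_hasGaussianLaw
    (hasGaussianLaw_fieldAt_limitField hW hμ κ w ht fun i => x i + h)
    (hasGaussianLaw_fieldAt_limitField hW hμ κ w ht x) (fun i => ?_) (fun i j => ?_)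
  · simp only [fieldAt]
    rw [integral_limitField hW hμ (ht i), integral_limitField hW hμ (ht i)]
  · simp only [fieldAt]
    have h2 := covariance_limitField hW hμ h0 h1 hw (ht i) (ht j) (x i + h) (x j + h)
    rw [add_sub_add_right_eq_sub, ← covariance_limitField hW hμ h0 h1 hw (ht i) (ht j)] at h2
    exact h2

lemma not_stationaryInTime_limitField (hW : IsWhiteNoise W P) {μ κ w : ℝ} (hμ : 0 < μ)
    (h0 : 0 < κ) (h1 : κ < 1) (hw : w ≠ 0) : ¬ StationaryInTime (limitField W P κ w μ) P := by
  intro h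
  -- One point suffices: the variances at times `1` and `2` are the same positive constant times
  -- `1/√2` and `1/√4`.
  have h2 := (h 1 one_pos 1 (fun _ => 1) (fun _ => 0) fun _ => one_pos).comp
    (u := fun v : Fin 1 → ℝ => v 0) (measurable_pi_apply 0)
  have h3 : Var[limitField W P κ w μ (1 + 1) 0; P] = Var[limitField W P κ w μ 1 0; P] :=
    h2.variance_eq
  have hm : ∀ t, 0 < t → AEMeasurable (limitField W P κ w μ t 0) P := fun t ht =>
    ((isGaussianProcess_limitField hW hμ κ w).aemeasurable (⟨t, ht⟩, 0))
  rw [← covariance_self (hm _ (by norm_num)), ← covariance_self (hm _ one_pos),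
    covariance_limitField hW hμ h0 h1 hw (by norm_num) (by norm_num),
    covariance_limitField hW hμ h0 h1 hw one_pos one_pos] at h3
  have hpos : 0 < cTwo κ * √Real.pi * (1 - theta κ |w|) / (√μ * |w| ^ (1 - κ)) := by
    have e : cTwo κ * √Real.pi * (1 - theta κ |w|) / (√μ * |w| ^ (1 - κ)) =
        cTwo κ / |w| ^ (1 - κ) * (1 - theta κ |w|) * (√Real.pi / √μ) := by ring
    rw [e, limitVariance_eq h0 h1 hw]
    exact mul_pos (mixtureDensity_pos h0 hw)
      (div_pos (Real.sqrt_pos.2 Real.pi_pos) (Real.sqrt_pos.2 hμ))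
  have h4 := mul_left_cancel₀ hpos.ne' h3
  simp only [sub_self, ne_eq, OfNat.ofNat_ne_zero, not_false_eq_true, zero_pow, neg_zero, zero_div,
    Real.exp_zero] at h4
  have h5 : √(1 + 1 : ℝ) < √(1 + 1 + (1 + 1)) := Real.sqrt_lt_sqrt (by norm_num) (by norm_num)
  have h6 : 0 < √(1 + 1 : ℝ) := Real.sqrt_pos.2 (by norm_num)
  exact absurd h4 (one_div_lt_one_div_of_lt h6 h5).ne

end Fields

theorem theorem3 {Ω Ω' : Type*} [MeasurableSpace Ω] [MeasurableSpace Ω']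
    (P : Measure Ω) [IsProbabilityMeasure P] (P' : Measure Ω') [IsProbabilityMeasure P']
    (μ κ w : ℝ) (hμ : 0 < μ) (hκ₀ : 0 < κ) (hκ₁ : κ < 1) (hw : w ≠ 0)
    -- the initial condition `η(x) = ∫ exp(i l x) Z(dl)`, with `E |Z(dl)|² = F(dl)`
    (F : Measure ℝ) [IsFiniteMeasure F] (Z : Set ℝ → Ω → ℂ) (hZ : IsGaussianRandomMeasure F Z P)
    (η : ℝ → Ω → ℝ)
    (hη : ∀ x : ℝ, ∀ᵐ ω ∂P,
      (η x ω : ℂ) = stochIntegral F Z P (fun l => Complex.exp (Complex.I * l * x)) ω)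
    (hcov : ∀ x : ℝ, cov[η 0, η x; P] = Real.cos (w * x) / (1 + x ^ 2) ^ (κ / 2))
    -- the white noise of the limit field
    (W : Set ℝ → Ω' → ℂ) (hW : IsWhiteNoise W P') :
    -- the solution is real, and it is the heat semigroup applied to the initial condition
    (∀ t x : ℝ, 0 < t → ∀ᵐ ω ∂P, solutionC F Z P μ t x ω = (solution F Z P μ t x ω : ℂ)) ∧
    (Measurable (Function.uncurry η) → ∀ t x : ℝ, 0 < t → ∀ᵐ ω ∂P,
      Integrable (fun y => η y ω * Real.exp (-(x - y) ^ 2 / (4 * μ * t))) ∧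
      solution F Z P μ t x ω =
        1 / √(4 * Real.pi * μ * t) * ∫ y, η y ω * Real.exp (-(x - y) ^ 2 / (4 * μ * t))) ∧
    -- the limit is a real zero-mean Gaussian field with the stated covariance function
    (∀ t x : ℝ, 0 < t →
      ∀ᵐ ω ∂P', limitFieldC W P' κ w μ t x ω = (limitField W P' κ w μ t x ω : ℂ)) ∧
    IsGaussianProcess (fun p : Set.Ioi (0 : ℝ) × ℝ => limitField W P' κ w μ p.1 p.2) P' ∧
    (∀ t x : ℝ, 0 < t → ∫ ω, limitField W P' κ w μ t x ω ∂P' = 0) ∧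
    (∀ t x t' x' : ℝ, 0 < t → 0 < t' →
      cov[limitField W P' κ w μ t x, limitField W P' κ w μ t' x'; P'] =
        cTwo κ * √Real.pi * (1 - theta κ |w|) / (√μ * |w| ^ (1 - κ)) *
          (Real.exp (-(x - x') ^ 2 / (4 * μ * (t + t'))) / √(t + t'))) ∧
    -- convergence of the finite-dimensional distributions
    FddTendsto (rescaled F Z P μ) P (limitField W P' κ w μ) P' ∧
    -- mean-square convergence of versions of the rescaled solutions
    (∀ ε : ℝ, 0 < ε →
      (∀ t x : ℝ, 0 < t → ∀ᵐ ω ∂P',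
        coupledFieldC W P' κ w μ ε t x ω = (coupledField W P' κ w μ ε t x ω : ℂ)) ∧
      SameFdd (rescaled F Z P μ ε) P (coupledField W P' κ w μ ε) P') ∧
    (∀ t x : ℝ, 0 < t →
      Tendsto (fun ε : ℝ => eLpNorm
        (fun ω => coupledField W P' κ w μ ε t x ω - limitField W P' κ w μ t x ω) 2 P')
        (𝓝[>] 0) (𝓝 0)) ∧
    -- the limit field is stationary in space but not in time
    StationaryInSpace (limitField W P' κ w μ) P' ∧
    ¬ StationaryInTime (limitField W P' κ w μ) P' := by
  have hF := spectralMeasure_eq hZ hκ₀ hκ₁ hη hcov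
  have hη' : ∀ x, η x =ᵐ[P] solution F Z P μ 0 x := fun x => by
    filter_upwards [hη x] with ω hω
    rw [solution, solutionC, ← heatKernelFourier_zero_time, ← hω, Complex.ofReal_re]
  exact ⟨fun t x ht => solutionC_eq_solution hZ hμ.le ht.le x,
    fun hm t x ht => solution_eq_heatSemigroup hZ hμ hη' hm ht x,
    fun t x ht => limitFieldC_eq_limitField hW hμ ht κ w x,
    isGaussianProcess_limitField hW hμ κ w,
    fun t x ht => integral_limitField hW hμ ht κ w x,
    fun t x t' x' ht ht' => covariance_limitField hW hμ hκ₀ hκ₁ hw ht ht' x x',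
    fddTendsto_rescaled hZ hW hμ hκ₀ hκ₁ hw hF,
    fun ε hε => ⟨fun t x ht => coupledFieldC_eq_coupledField hW w hμ hκ₀ hκ₁ hε ht x,
      sameFdd_rescaled_coupledField hZ hW hμ hκ₀ hκ₁ hF hε⟩,
    fun t x ht => tendsto_eLpNorm_coupledField_sub hW hκ₀ hκ₁ hw hμ ht x,
    stationaryInSpace_limitField hW hμ hκ₀ hκ₁ hw,
    not_stationaryInTime_limitField hW hμ hκ₀ hκ₁ hw⟩
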